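/- For $0<q<1$ write $(a;q)_n=\prod_{i=0}^{n-1}(1-aq^i)$, $(a;q)_\infty=\prod_{i\ge0}(1-aq^i)$ and $(a_1,\dots,a_k;q)_\infty=\prod_{r=1}^{k}(a_r;q)_\infty$. The Jackson $q$-integral is $\int_0^\alpha f(x)\,d_qx=(1-q)\sum_{k\ge0}\alpha q^k f(\alpha q^k)$ and $\int_a^b f\,d_qx=\int_0^b f\,d_qx-\int_0^a f\,d_qx$. Let $$\omega(x)=\frac{(qx,-qx;q)_\infty}{(q,-1,-q;q)_\infty},\qquad H_n(x;q)=\sum_{0\le k\le n/2}(-1)^k\frac{(q^{-n};q^2)_k\,(q^{-n+1};q^2)_k\,q^{k(2n-k)}}{(q^2;q^2)_k}\,x^{n-2k}$$ be the discrete $q$-Hermite weight and polynomials, let $$\rho_N(x)=\frac1{1-q}\sum_{j=0}^{N-1}\frac{H_j(x;q)^2}{(q;q)_j\,q^{j(j-1)/2}}\,\omega(x),\qquad \widehat\rho_N(x)=\sqrt{1-q}\,\rho_N(\sqrt{1-q}\,x)$$ be the density of the discrete $q$-deformed GUE and its rescaling, and let $$m^{(dH)}_{N,2p}=\int_{-1}^1|x|^{2p}\rho_N(x)\,d_qx,\qquad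 \widehat m^{(dH)}_{N,2p}=\int_{-1/\sqrt{1-q}}^{1/\sqrt{1-q}}|x|^{2p}\,\widehat\rho_N(x)\,d_qx$$ be the spectral moments. Let $I_x(a,b)=\frac{\Gamma(a+b)}{\Gamma(a)\Gamma(b)}\int_0^x t^{a-1}(1-t)^{b-1}\,dt$ be the regularised incomplete beta function. Theorem 2.2. Fix $\lambda>0$ and a positive integer $p$, and for each $N\ge1$ take $q=e^{-\lambda/N}$. Then for every $N\ge 1$ the series defining $m^{(dH)}_{N,2p}$ and $\widehat m^{(dH)}_{N,2p}$ converge and $q^p m^{(dH)}_{N,2p}=\big(q(1-q)\big)^p\,\widehat m^{(dH)}_{N,2p}$, and as $N\to\infty$ $$q^p m^{(dH)}_{N,2p}=\mathcal M_{2p,0}\,N+\frac{\mathcal M_{2p,1}}{N}+O\Big(\frac1{N^3}\Big),$$ where $$\mathcal M_{2p,0}=\frac1{\lambda p}\,I_{1-e^{-\lambda}}(p+1,p),$$ $$\mathcal M_{2p,1}=-\frac{\lambda p}{6}\bigg(I_{1-e^{-\lambda}}(p+1,p)+\frac{(2p-1)!}{p!\,(p-1)!}\,e^{-p\lambda}(1-e^{-\lambda})^{p-1}\Big(2+p-(2p+1)e^{-\lambda}\Big)\bigg).$$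 -/

import Mathlib

open Filter Asymptotics

noncomputable section

namespace DiscreteQGUE

/-- The finite `q`-shifted factorial `(a;q)_n = (1-a)(1-aq)⋯(1-aq^{n-1})`. -/
def qPoch (a q : ℝ) (n : ℕ) : ℝ :=
  ∏ i ∈ Finset.range n, (1 - a * q ^ i)

/-- The infinite `q`-shifted factorial `(a;q)_∞ = ∏_{l ≥ 0} (1 - a q^l)`. -/
def qPochInf (a q : ℝ) : ℝ :=
  ∏' l : ℕ, (1 - a * q ^ l)

/-- The product defining `(a;q)_∞` converges for `|q| < 1`. -/
theorem multipliable_qPochInf (a q : ℝ) (hq : |q| < 1) :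
    Multipliable fun l : ℕ => 1 - a * q ^ l := by
  have h : Summable fun l : ℕ => ‖-(a * q ^ l)‖ := by
    simpa [abs_mul] using (summable_geometric_of_abs_lt_one (r := |q|) (by simpa using hq)).mul_left |a|
  simpa [sub_eq_add_neg] using multipliable_one_add_of_summable h

/-- The Jackson `q`-integral `∫_0^α f(x) d_q x = (1-q) ∑_{k ≥ 0} α q^k f(α q^k)`. -/
def jacksonFromZero (q α : ℝ) (f : ℝ → ℝ) : ℝ :=
  (1 - q) * ∑' k : ℕ, α * q ^ k * f (α * q ^ k)

/-- The Jackson `q`-integral `∫_a^b f(x) d_q x = ∫_0^b f(x) d_q x - ∫_0^a f(x) d_q x`. -/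
def jacksonIntegral (q a b : ℝ) (f : ℝ → ℝ) : ℝ :=
  jacksonFromZero q b f - jacksonFromZero q a f

/-- Both series that define `∫_a^b f(x) d_q x` converge. -/
def JacksonIntegrable (q a b : ℝ) (f : ℝ → ℝ) : Prop :=
  (Summable fun k : ℕ => b * q ^ k * f (b * q ^ k)) ∧
    Summable fun k : ℕ => a * q ^ k * f (a * q ^ k)

/-- The discrete `q`-Hermite weight `ω(x) = (qx, -qx; q)_∞ / (q, -1, -q; q)_∞`. -/
def weight (q x : ℝ) : ℝ :=
  (qPochInf (q * x) q * qPochInf (-(q * x)) q) /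
    (qPochInf q q * qPochInf (-1) q * qPochInf (-q) q)

/-- The (monic) discrete `q`-Hermite polynomial
`H_n(x;q) = ∑_{0 ≤ k ≤ n/2} (-1)^k (q^{-n};q^2)_k (q^{-n+1};q^2)_k q^{k(2n-k)} / (q^2;q^2)_k x^{n-2k}`.
The natural-number subtractions are exact since `2k ≤ n`. -/
def hermite (n : ℕ) (q x : ℝ) : ℝ :=
  ∑ k ∈ Finset.range (n / 2 + 1),
    (-1) ^ k *
      (qPoch (q ^ (-(n : ℤ))) (q ^ 2) k * qPoch (q ^ (-(n : ℤ) + 1)) (q ^ 2) k *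
          q ^ (k * (2 * n - k)) / qPoch (q ^ 2) (q ^ 2) k) *
      x ^ (n - 2 * k)

/-- The density of the discrete `q`-GUE,
`ρ_N(x) = (1-q)^{-1} ∑_{j < N} H_j(x;q)^2 / ((q;q)_j q^{j(j-1)/2}) ω(x)`. -/
def density (N : ℕ) (q x : ℝ) : ℝ :=
  1 / (1 - q) *
    (∑ j ∈ Finset.range N, hermite j q x ^ 2 / (qPoch q q j * q ^ (j * (j - 1) / 2))) *
    weight q x

/-- The rescaled density `ρ̂_N(x) = √(1-q) ρ_N(√(1-q) x)`. -/
def densityHat (N : ℕ) (q x : ℝ) : ℝ :=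
  √(1 - q) * density N q (√(1 - q) * x)

/-- The spectral moment `m_{N,2p} = ∫_{-1}^1 |x|^{2p} ρ_N(x) d_q x`. -/
def moment (N p : ℕ) (q : ℝ) : ℝ :=
  jacksonIntegral q (-1) 1 fun x => |x| ^ (2 * p) * density N q x

/-- The rescaled spectral moment
`m̂_{N,2p} = ∫_{-1/√(1-q)}^{1/√(1-q)} |x|^{2p} ρ̂_N(x) d_q x`. -/
def momentHat (N p : ℕ) (q : ℝ) : ℝ :=
  jacksonIntegral q (-1 / √(1 - q)) (1 / √(1 - q)) fun x => |x| ^ (2 * p) * densityHat N q x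

/-- The regularised incomplete beta function
`I_x(a,b) = Γ(a+b) / (Γ(a) Γ(b)) ∫_0^x t^{a-1} (1-t)^{b-1} dt`. -/
def regIncBeta (x a b : ℝ) : ℝ :=
  Real.Gamma (a + b) / (Real.Gamma a * Real.Gamma b) *
    ∫ t in (0 : ℝ)..x, t ^ (a - 1) * (1 - t) ^ (b - 1)

/-- The scaling `q = e^{-λ/N}`. -/
def scaledQ (lam : ℝ) (N : ℕ) : ℝ :=
  Real.exp (-lam / N)

/-- The leading coefficient `ℳ_{2p,0}`. -/
def genusZeroCoeff (p : ℕ) (lam : ℝ) : ℝ :=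
  1 / (lam * p) * regIncBeta (1 - Real.exp (-lam)) (p + 1) p

/-- The first correction `ℳ_{2p,1}`. -/
def genusOneCoeff (p : ℕ) (lam : ℝ) : ℝ :=
  -(lam * p / 6) *
    (regIncBeta (1 - Real.exp (-lam)) (p + 1) p +
      ((2 * p - 1).factorial : ℝ) / ((p.factorial : ℝ) * ((p - 1).factorial : ℝ)) *
        Real.exp (-(p * lam)) * (1 - Real.exp (-lam)) ^ (p - 1) *
        (2 + p - (2 * p + 1) * Real.exp (-lam)))

end DiscreteQGUE

end

/-!
The discrete `q`-Hermite polynomials are orthogonal for the weight `ω` and satisfy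
`x H_n = H_{n+1} + q^{n-1}(1 - q^n) H_{n-1}`, so `∫ x^{2p} H_j² ω d_q x`, normalised, is a sum over
closed lattice paths with `2p` steps, in which a down-step from the height `h` has the weight
`q^{j+h-1}(1 - q^{j+h})`.

Put `q = e^{-θ}` and measure heights at the midpoints of the steps. Expanding the product of the
factors `e^{-t} - e^{-2t}` along the down-steps amounts to marking some of them, and the reflection
of the paths turns the dependence on the heights into a hyperbolic cosine. The sum over `j < N` is
then geometric: a path with `A` down-steps, the marked ones counted twice, contributes
`± (1 - e^{-θAN}) cosh(θD) / (2 sinh(θA/2))`, where `D` is the total midpoint height of these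
down-steps. For `θ = λ/N` this function is odd in `1/N` up to the constant `1 - e^{-λA}`, so its
expansion has only the powers `N`, `1/N`, `1/N³`, ….

The two coefficients are finite sums over paths, as functions of `u = e^{-λ}`. Their derivatives
involve only the first two moments of `A` and `D`, which are computed from the covariances of the
steps of a uniformly random closed path, and the resulting differential equations are solved by
the incomplete beta integral, all functions vanishing at `u = 1`.
-/

noncomputable section

namespace DiscreteQGUE

open Finset Topology

section QShiftedFactorial

variable {a q : ℝ}

theorem qPoch_succ (a q : ℝ) (n : ℕ) : qPoch a q (n + 1) = qPoch a q n * (1 - a * q ^ n) :=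
  prod_range_succ _ _

theorem qPoch_two_mul (a q : ℝ) (n : ℕ) :
    qPoch a q (2 * n) = qPoch a (q ^ 2) n * qPoch (a * q) (q ^ 2) n := by
  induction n with
  | zero => simp [qPoch]
  | succ n ih =>
    rw [show 2 * (n + 1) = 2 * n + 1 + 1 by ring, qPoch_succ, qPoch_succ, qPoch_succ, qPoch_succ,
      ih]
    ring

theorem qPoch_mul_qPoch_neg (a q : ℝ) (n : ℕ) :
    qPoch a q n * qPoch (-a) q n = qPoch (a ^ 2) (q ^ 2) n := by
  rw [qPoch, qPoch, qPoch, ← prod_mul_distrib]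
  exact prod_congr rfl fun i _ => by ring

theorem mul_pow_ne_one (ha : |a| ≤ 1) (ha1 : a ≠ 1) (hq : |q| < 1) (n : ℕ) : a * q ^ n ≠ 1 := by
  rcases n.eq_zero_or_pos with rfl | hn
  · simpa using ha1
  · refine ne_of_apply_ne abs (ne_of_lt ?_)
    rw [abs_mul, abs_pow, abs_one]
    exact (mul_le_of_le_one_left (by positivity) ha).trans_lt
      (pow_lt_one₀ (abs_nonneg q) hq hn.ne')

theorem qPoch_ne_zero (ha : |a| ≤ 1) (ha1 : a ≠ 1) (hq : |q| < 1) (n : ℕ) : qPoch a q n ≠ 0 :=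
  prod_ne_zero_iff.2 fun i _ => sub_ne_zero.2 (mul_pow_ne_one ha ha1 hq i).symm

theorem qPochInf_ne_zero (ha : |a| ≤ 1) (ha1 : a ≠ 1) (hq : |q| < 1) : qPochInf a q ≠ 0 := by
  have hsum : Summable fun l : ℕ => ‖-(a * q ^ l)‖ := by
    simpa [abs_mul] using (summable_geometric_of_abs_lt_one (r := |q|) (by simpa)).mul_left |a|
  have hfactor (l : ℕ) : 1 + -(a * q ^ l) ≠ 0 := by
    rw [← sub_eq_add_neg]
    exact sub_ne_zero.2 (mul_pow_ne_one ha ha1 hq l).symm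
  simpa [qPochInf, sub_eq_add_neg] using tprod_one_add_ne_zero_of_summable hfactor hsum

theorem qPochInf_eq_mul (a : ℝ) (hq : |q| < 1) :
    qPochInf a q = (1 - a) * qPochInf (q * a) q := by
  have hshift : (fun l : ℕ => 1 - a * q ^ (l + 1)) = fun l => 1 - q * a * q ^ l := by
    funext l
    ring
  rw [qPochInf, tprod_eq_zero_mul' (by rw [hshift]; exact multipliable_qPochInf _ _ hq), hshift,
    pow_zero, mul_one, qPochInf]

theorem tendsto_qPoch (a : ℝ) (hq : |q| < 1) :
    Tendsto (qPoch a q) atTop (𝓝 (qPochInf a q)) :=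
  (multipliable_qPochInf a q hq).tendsto_prod_tprod_nat

theorem abs_sq_lt_one (hq : |q| < 1) : |q ^ 2| < 1 := by
  rw [abs_pow]
  exact pow_lt_one₀ (abs_nonneg q) hq two_ne_zero

theorem ne_one_of_abs_lt_one (hq : |q| < 1) : q ≠ 1 := by
  rintro rfl
  simp at hq

theorem qPoch_self_ne_zero (hq : |q| < 1) (n : ℕ) : qPoch q q n ≠ 0 :=
  qPoch_ne_zero hq.le (ne_one_of_abs_lt_one hq) hq n

theorem qPochInf_self_ne_zero (hq : |q| < 1) : qPochInf q q ≠ 0 :=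
  qPochInf_ne_zero hq.le (ne_one_of_abs_lt_one hq) hq

theorem qPochInf_neg_self_ne_zero (hq : |q| < 1) : qPochInf (-q) q ≠ 0 :=
  qPochInf_ne_zero (by simpa using hq.le) (ne_one_of_abs_lt_one (by simpa using hq)) hq

/- `(q;q)_{2m} = (q;q²)_m (q²;q²)_m = (q;q²)_m (q;q)_m (-q;q)_m`; let `m → ∞`. -/
theorem qPochInf_sq_mul_qPochInf_neg (hq : |q| < 1) :
    qPochInf q (q ^ 2) * qPochInf (-q) q = 1 := by
  have hfinite (m : ℕ) :
      qPoch q q (2 * m) = qPoch q (q ^ 2) m * (qPoch q q m * qPoch (-q) q m) := by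
    rw [qPoch_two_mul, qPoch_mul_qPoch_neg, sq q]
  have hleft : Tendsto (fun m => qPoch q q (2 * m)) atTop (𝓝 (qPochInf q q)) :=
    (tendsto_qPoch q hq).comp (tendsto_id.const_mul_atTop' two_pos)
  have hright := (tendsto_qPoch q (abs_sq_lt_one hq)).mul
    ((tendsto_qPoch q hq).mul (tendsto_qPoch (-q) hq))
  simp only [← hfinite] at hright
  refine mul_left_cancel₀ (qPochInf_self_ne_zero hq) ?_
  linear_combination -(tendsto_nhds_unique hleft hright)

theorem summable_pow_mul_of_tendsto {r L : ℝ} {g : ℕ → ℝ} (hr : |r| < 1)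
    (hg : Tendsto g atTop (𝓝 L)) : Summable fun k => r ^ k * g k := by
  refine summable_of_isBigO_nat (summable_geometric_of_abs_lt_one (r := r) hr) ?_
  simpa using (isBigO_refl (fun k : ℕ => r ^ k) atTop).mul (hg.isBigO_one ℝ)

/-- Euler's `q`-exponential function `∑_{k ≥ 0} z^k / (q;q)_k`, which converges for `|z| < 1`. -/
def qExp (q z : ℝ) : ℝ := ∑' k : ℕ, z ^ k / qPoch q q k

variable {z : ℝ}

theorem summable_qExp (hq : |q| < 1) (hz : |z| < 1) : Summable fun k => z ^ k / qPoch q q k := by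
  simpa only [div_eq_mul_inv] using summable_pow_mul_of_tendsto hz
    ((tendsto_qPoch q hq).inv₀ (qPochInf_self_ne_zero hq))

theorem qExp_mul (hq : |q| < 1) (hz : |z| < 1) : qExp q (q * z) = (1 - z) * qExp q z := by
  have hqz : |q * z| < 1 := by
    rw [abs_mul]
    exact mul_lt_one_of_nonneg_of_lt_one_left (abs_nonneg q) hq hz.le
  have hterm (k : ℕ) : z ^ (k + 1) / qPoch q q (k + 1) - (q * z) ^ (k + 1) / qPoch q q (k + 1) =
      z * (z ^ k / qPoch q q k) := by
    have h := qPoch_self_ne_zero hq (k + 1)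
    rw [qPoch_succ, ← pow_succ'] at h ⊢
    have h₁ := left_ne_zero_of_mul h
    have h₂ := right_ne_zero_of_mul h
    field_simp
    ring
  have hdiff : qExp q z - qExp q (q * z) = z * qExp q z := by
    rw [qExp, qExp, ← (summable_qExp hq hz).tsum_sub (summable_qExp hq hqz),
      ((summable_qExp hq hz).sub (summable_qExp hq hqz)).tsum_eq_zero_add, ← tsum_mul_left]
    simp [hterm]
  linear_combination -hdiff

theorem qExp_mul_pow (hq : |q| < 1) (hz : |z| < 1) (m : ℕ) :
    qExp q (z * q ^ m) = qPoch z q m * qExp q z := by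
  induction m with
  | zero => simp [qPoch]
  | succ m ih =>
    have hzm : |z * q ^ m| < 1 := by
      rw [abs_mul, abs_pow]
      exact mul_lt_one_of_nonneg_of_lt_one_left (abs_nonneg z) hz
        (pow_le_one₀ (abs_nonneg q) hq.le)
    rw [pow_succ', mul_left_comm, qExp_mul hq hzm, ih, qPoch_succ]
    ring

theorem tendsto_qExp_mul_pow (hq : |q| < 1) (hz : |z| < 1) :
    Tendsto (fun m : ℕ => qExp q (z * q ^ m)) atTop (𝓝 1) := by
  have hlimit : ∑' k : ℕ, (if k = 0 then (1 : ℝ) else 0) = 1 := by simp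
  rw [← hlimit]
  refine tendsto_tsum_of_dominated_convergence (summable_qExp hq hz).norm (fun k => ?_)
    (Eventually.of_forall fun m k => ?_)
  · rcases k.eq_zero_or_pos with rfl | hk
    · simp [qPoch]
    · have hpow : Tendsto (fun m : ℕ => (z * q ^ m) ^ k) atTop (𝓝 ((z * 0) ^ k)) :=
        ((tendsto_pow_atTop_nhds_zero_of_abs_lt_one hq).const_mul z).pow k
      simpa [hk.ne'] using hpow.div_const (qPoch q q k)
  · simp only [mul_pow, norm_div, norm_mul, norm_pow]
    gcongr
    exact mul_le_of_le_one_right (by positivity)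
      (pow_le_one₀ (by positivity) (pow_le_one₀ (norm_nonneg q) hq.le))

theorem qPochInf_mul_qExp (hq : |q| < 1) (hz : |z| < 1) : qPochInf z q * qExp q z = 1 := by
  refine tendsto_nhds_unique ((tendsto_qPoch z hq).mul_const (qExp q z)) ?_
  simpa only [qExp_mul_pow hq hz] using tendsto_qExp_mul_pow hq hz

end QShiftedFactorial

section Hermite

variable {q : ℝ}

/-- The falling `q`-product `(1 - q^n)(1 - q^{n-1})⋯(1 - q^{n-m+1})`. The truncated subtraction
makes it vanish for `m > n`, as it should. -/
def qFalling (q : ℝ) (n m : ℕ) : ℝ := ∏ i ∈ range m, (1 - q ^ (n - i))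

theorem qFalling_succ (q : ℝ) (n m : ℕ) :
    qFalling q n (m + 1) = qFalling q n m * (1 - q ^ (n - m)) :=
  prod_range_succ _ _

theorem qFalling_succ_succ (q : ℝ) (n m : ℕ) :
    qFalling q (n + 1) (m + 1) = (1 - q ^ (n + 1)) * qFalling q n m := by
  simp [qFalling, prod_range_succ', mul_comm]

theorem qFalling_eq_zero (q : ℝ) {n m : ℕ} (h : n < m) : qFalling q n m = 0 :=
  prod_eq_zero (mem_range.2 h) (by simp)

theorem qPoch_zpow_neg_mul_pow (hq0 : q ≠ 0) {n m : ℕ} (hmn : m ≤ n) :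
    qPoch (q ^ (-(n : ℤ))) q m * q ^ (n * m) =
      (-1) ^ m * q ^ m.choose 2 * qFalling q n m := by
  induction m with
  | zero => simp [qPoch, qFalling]
  | succ m ih =>
    have hfactor : (1 - q ^ (-(n : ℤ)) * q ^ m) * q ^ n = -q ^ m * (1 - q ^ (n - m)) := by
      have hsplit : q ^ m * q ^ (n - m) = q ^ n := by rw [← pow_add, Nat.add_sub_of_le (by lia)]
      rw [zpow_neg, zpow_natCast]
      field_simp
      linear_combination -hsplit
    rw [qPoch_succ, qFalling_succ, Nat.choose_succ_succ, Nat.choose_one_right, pow_add q m,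
      mul_add_one, pow_add q (n * m)]
    linear_combination (1 - q ^ (-(n : ℤ)) * q ^ m) * q ^ n * ih (by lia) +
      (-1) ^ m * q ^ m.choose 2 * qFalling q n m * hfactor

/-- The coefficient of `x^{n-2k}` in the discrete `q`-Hermite polynomial of degree `n`. -/
def hermiteCoeff (q : ℝ) (n k : ℕ) : ℝ :=
  (-1) ^ k * q ^ (k * (k - 1)) * qFalling q n (2 * k) / qPoch (q ^ 2) (q ^ 2) k

theorem hermiteCoeff_eq_zero (q : ℝ) {n k : ℕ} (h : n < 2 * k) : hermiteCoeff q n k = 0 := by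
  simp [hermiteCoeff, qFalling_eq_zero q h]

theorem hermiteCoeff_zero (q : ℝ) (n : ℕ) : hermiteCoeff q n 0 = 1 := by
  simp [hermiteCoeff, qFalling, qPoch]

theorem qPoch_mul_qPoch_eq_qFalling (hq0 : q ≠ 0) {n k : ℕ} (hk : 2 * k ≤ n) :
    qPoch (q ^ (-(n : ℤ))) (q ^ 2) k * qPoch (q ^ (-(n : ℤ) + 1)) (q ^ 2) k *
      q ^ (k * (2 * n - k)) = q ^ (k * (k - 1)) * qFalling q n (2 * k) := by
  have hexponent : n * (2 * k) = k * (2 * n - k) + k ^ 2 := by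
    zify [show k ≤ 2 * n by lia]
    ring
  have hchoose : (2 * k).choose 2 = k * (k - 1) + k ^ 2 := by
    rw [Nat.choose_two_right, mul_assoc, Nat.mul_div_cancel_left _ two_pos]
    rcases k with _ | k
    · rfl
    · zify [show 1 ≤ 2 * (k + 1) by lia]
      simp only [Nat.add_sub_cancel]
      ring
  have h := qPoch_zpow_neg_mul_pow hq0 hk
  rw [qPoch_two_mul, hexponent, hchoose, pow_mul, pow_add q, pow_add q, neg_one_sq, one_pow,
    one_mul, ← zpow_add_one₀ hq0] at h
  refine mul_right_cancel₀ (pow_ne_zero (k ^ 2) hq0) ?_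
  linear_combination h

theorem hermite_eq_sum (hq0 : q ≠ 0) {n K : ℕ} (hK : n < 2 * K) (x : ℝ) :
    hermite n q x = ∑ k ∈ range K, hermiteCoeff q n k * x ^ (n - 2 * k) := by
  rw [hermite, ← sum_subset (range_subset_range.2 (show n / 2 + 1 ≤ K by lia))]
  · refine sum_congr rfl fun k hk => ?_
    rw [mem_range] at hk
    rw [qPoch_mul_qPoch_eq_qFalling hq0 (by lia), hermiteCoeff, mul_div_assoc', mul_assoc]
  · intro k _ hk
    rw [mem_range] at hk
    rw [hermiteCoeff_eq_zero q (by lia), zero_mul]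

theorem mul_hermite_eq_sum (hq0 : q ≠ 0) {n K : ℕ} (hK : n < 2 * K) (x : ℝ) :
    x * hermite n q x = ∑ k ∈ range K, hermiteCoeff q n k * x ^ (n + 1 - 2 * k) := by
  rw [hermite_eq_sum hq0 hK, mul_sum]
  refine sum_congr rfl fun k _ => ?_
  rcases lt_or_ge n (2 * k) with h | h
  · simp [hermiteCoeff_eq_zero q h]
  · rw [Nat.sub_add_comm h, pow_succ]
    ring

/-- The coefficient `q^{n-1}(1 - q^n)` of the three-term recurrence. Its index is an integer, so
that it can be evaluated at the heights of a lattice path. -/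
def recCoeff (q : ℝ) (n : ℤ) : ℝ := q ^ (n - 1) * (1 - q ^ n)

theorem recCoeff_zero (q : ℝ) : recCoeff q 0 = 0 := by simp [recCoeff]

theorem recCoeff_succ (q : ℝ) (n : ℕ) : recCoeff q (n + 1) = q ^ n * (1 - q ^ (n + 1)) := by
  rw [recCoeff, add_sub_cancel_right]
  exact_mod_cast rfl

theorem hermiteCoeff_recurrence (hq : |q| < 1) (n k : ℕ) :
    hermiteCoeff q (n + 1) (k + 1) =
      hermiteCoeff q (n + 2) (k + 1) + recCoeff q (n + 1) * hermiteCoeff q n k := by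
  rcases lt_or_ge n (2 * k) with h | h
  · simp [hermiteCoeff_eq_zero, h, show n + 1 < 2 * (k + 1) by lia,
      show n + 2 < 2 * (k + 1) by lia]
  have hpoch := qPoch_self_ne_zero (abs_sq_lt_one hq) (k + 1)
  have hpow : q ^ n = q ^ (2 * k) * q ^ (n - 2 * k) := by rw [← pow_add, Nat.add_sub_of_le h]
  have hexponent : (k + 1) * (k + 1 - 1) = k * (k - 1) + 2 * k := by
    rcases k with _ | k
    · rfl
    · simp only [Nat.add_sub_cancel]
      ring
  rw [qPoch_succ] at hpoch
  have hpoch_left := left_ne_zero_of_mul hpoch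
  have hpoch_right := right_ne_zero_of_mul hpoch
  rw [hermiteCoeff, hermiteCoeff, hermiteCoeff, recCoeff_succ, hexponent, mul_add_one 2 k,
    qFalling_succ_succ, qFalling_succ_succ q (n + 1), qFalling_succ_succ, qFalling_succ,
    qPoch_succ, pow_succ' (-1 : ℝ), pow_add q (k * (k - 1)), pow_add q n 2, pow_succ q n, hpow]
  field_simp
  ring

theorem mul_hermite (hq0 : q ≠ 0) (hq : |q| < 1) (n : ℕ) (x : ℝ) :
    x * hermite n q x = hermite (n + 1) q x + recCoeff q n * hermite (n - 1) q x := by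
  rcases n with _ | n
  · simp [recCoeff_zero, hermite, qPoch]
  · rw [mul_hermite_eq_sum hq0 (show n + 1 < 2 * (n + 1 + 1) by lia),
      hermite_eq_sum hq0 (show n + 1 + 1 < 2 * (n + 1 + 1) by lia), Nat.add_sub_cancel,
      hermite_eq_sum hq0 (show n < 2 * (n + 1) by lia), sum_range_succ' _ (n + 1),
      sum_range_succ' _ (n + 1), mul_sum, add_right_comm (∑ _ ∈ _, _),
      ← sum_add_distrib, hermiteCoeff_zero, hermiteCoeff_zero]
    congr 1
    refine sum_congr rfl fun k _ => ?_
    rw [hermiteCoeff_recurrence hq, Nat.cast_add_one,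
      show n + 1 + 1 - 2 * (k + 1) = n - 2 * k by lia]
    ring

theorem hermite_zero (q x : ℝ) : hermite 0 q x = 1 := by simp [hermite, qPoch]

@[fun_prop]
theorem continuous_hermite (n : ℕ) (q : ℝ) : Continuous (hermite n q) := by
  unfold hermite
  fun_prop

theorem hermite_forward_shift (hq0 : q ≠ 0) (n : ℕ) (x : ℝ) :
    hermite (n + 1) q x - hermite (n + 1) q (q * x) =
      (1 - q ^ (n + 1)) * (x * hermite n q x) := by
  have hn : n + 1 < 2 * (n + 1) := by lia
  rw [mul_hermite_eq_sum hq0 (show n < 2 * (n + 1) by lia), hermite_eq_sum hq0 hn,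
    hermite_eq_sum hq0 hn, ← sum_sub_distrib, mul_sum]
  refine sum_congr rfl fun k _ => ?_
  have hcoeff : hermiteCoeff q (n + 1) k * (1 - q ^ (n + 1 - 2 * k)) =
      (1 - q ^ (n + 1)) * hermiteCoeff q n k := by
    have h := (qFalling_succ q (n + 1) (2 * k)).symm.trans (qFalling_succ_succ q n (2 * k))
    rw [hermiteCoeff, hermiteCoeff]
    linear_combination (-1) ^ k * q ^ (k * (k - 1)) / qPoch (q ^ 2) (q ^ 2) k * h
  rw [mul_pow]
  linear_combination x ^ (n + 1 - 2 * k) * hcoeff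

theorem hermite_backward_shift (hq0 : q ≠ 0) (hq : |q| < 1) (n : ℕ) (x : ℝ) :
    q ^ n * (hermite n q x - (1 - x ^ 2) * hermite n q (x / q)) = x * hermite (n + 1) q x := by
  obtain ⟨y, rfl⟩ : ∃ y, x = q * y := ⟨x / q, by field_simp⟩
  rw [mul_div_cancel_left₀ _ hq0]
  have hshift_succ := hermite_forward_shift hq0 n y
  have hrec := mul_hermite hq0 hq n y
  have hshift : q ^ n * (hermite n q y - hermite n q (q * y)) =
      q * recCoeff q n * (y * hermite (n - 1) q y) := by
    rcases n with _ | n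
    · simp [hermite_zero, recCoeff_zero]
    · rw [hermite_forward_shift hq0, Nat.cast_add_one, recCoeff_succ, Nat.add_sub_cancel]
      ring
  linear_combination -hshift + q * y * hshift_succ + q * y * hrec

end Hermite

section JacksonIntegral

variable {q a b α : ℝ} {f g : ℝ → ℝ}

theorem jacksonIntegral_add (hf : JacksonIntegrable q a b f) (hg : JacksonIntegrable q a b g) :
    jacksonIntegral q a b (fun x => f x + g x) =
      jacksonIntegral q a b f + jacksonIntegral q a b g := by
  simp only [jacksonIntegral, jacksonFromZero, mul_add, hf.1.tsum_add hg.1, hf.2.tsum_add hg.2]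
  ring

theorem jacksonIntegral_const_mul (q a b c : ℝ) (f : ℝ → ℝ) :
    jacksonIntegral q a b (fun x => c * f x) = c * jacksonIntegral q a b f := by
  simp only [jacksonIntegral, jacksonFromZero, mul_left_comm _ c, tsum_mul_left]
  ring

theorem jacksonIntegral_sum {ι : Type*} {s : Finset ι} {f : ι → ℝ → ℝ}
    (hf : ∀ i ∈ s, JacksonIntegrable q a b (f i)) :
    jacksonIntegral q a b (fun x => ∑ i ∈ s, f i x) = ∑ i ∈ s, jacksonIntegral q a b (f i) := by
  simp only [jacksonIntegral, jacksonFromZero, mul_sum, Summable.tsum_finsetSum fun i hi =>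
    (hf i hi).1, Summable.tsum_finsetSum fun i hi => (hf i hi).2, sum_sub_distrib]

theorem jacksonFromZero_neg (q α : ℝ) (f : ℝ → ℝ) :
    jacksonFromZero q (-α) f = -jacksonFromZero q α fun x => f (-x) := by
  simp only [jacksonFromZero, neg_mul, tsum_neg, mul_neg]

theorem jacksonFromZero_eq_of_mul_eq_sub {F : ℝ → ℝ} {L : ℝ} (hq0 : q ≠ 0)
    (hf : Summable fun k : ℕ => α * q ^ k * f (α * q ^ k))
    (hF : ∀ x, x * f x = F x - F (x / q))
    (hL : Tendsto (fun k : ℕ => F (α * q ^ k)) atTop (𝓝 L)) :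
    jacksonFromZero q α f = (1 - q) * (L - F (α / q)) := by
  have hpartial (K : ℕ) : ∑ k ∈ range (K + 1), α * q ^ k * f (α * q ^ k) =
      F (α * q ^ K) - F (α / q) := by
    induction K with
    | zero => simp [hF]
    | succ K ih =>
      rw [sum_range_succ, ih, hF, pow_succ, ← mul_assoc, mul_div_cancel_right₀ _ hq0]
      ring
  have hsum := hf.hasSum.tendsto_sum_nat.comp (tendsto_add_atTop_nat 1)
  rw [jacksonFromZero, tendsto_nhds_unique hsum ((hL.sub_const _).congr fun K => (hpartial K).symm)]

end JacksonIntegral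

section Weight

variable {q c : ℝ} {f g : ℝ → ℝ}

theorem weight_neg (q x : ℝ) : weight q (-x) = weight q x := by
  simp [weight, mul_comm (qPochInf (q * x) q)]

theorem weight_div (hq0 : q ≠ 0) (hq : |q| < 1) (x : ℝ) :
    weight q (x / q) = (1 - x ^ 2) * weight q x := by
  rw [weight, weight, mul_div_cancel₀ _ hq0, qPochInf_eq_mul x hq, qPochInf_eq_mul (-x) hq, mul_neg]
  ring

theorem weight_one (hq : |q| < 1) : weight q 1 = (2 * qPochInf (-q) q)⁻¹ := by
  have hself := qPochInf_self_ne_zero hq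
  have hneg := qPochInf_neg_self_ne_zero hq
  rw [weight, mul_one, qPochInf_eq_mul (-1) hq, mul_neg_one]
  field_simp
  norm_num

theorem weight_pow (hq0 : q ≠ 0) (hq : |q| < 1) (k : ℕ) :
    weight q (q ^ k) = weight q 1 / qPoch (q ^ 2) (q ^ 2) k := by
  induction k with
  | zero => simp [qPoch]
  | succ k ih =>
    have hstep := weight_div hq0 hq (q ^ (k + 1))
    have hpoch := qPoch_self_ne_zero (abs_sq_lt_one hq) (k + 1)
    rw [pow_succ q k, mul_div_cancel_right₀ _ hq0, ← pow_succ, ih,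
      div_eq_iff (qPoch_self_ne_zero (abs_sq_lt_one hq) k)] at hstep
    rw [eq_div_iff hpoch, hstep, qPoch_succ]
    ring

theorem weight_mul_of_abs_eq_one (hc : |c| = 1) (x : ℝ) : weight q (c * x) = weight q x := by
  rcases eq_or_eq_neg_of_abs_eq hc with rfl | rfl <;> simp [weight_neg]

theorem tendsto_mul_weight (hq0 : q ≠ 0) (hq : |q| < 1) (hf : Continuous f) (hc : |c| = 1) :
    Tendsto (fun k : ℕ => f (c * q ^ k) * weight q (c * q ^ k)) atTop
      (𝓝 (f 0 * (weight q 1 / qPochInf (q ^ 2) (q ^ 2)))) := by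
  have hsq := abs_sq_lt_one hq
  have hpoint : Tendsto (fun k : ℕ => c * q ^ k) atTop (𝓝 0) := by
    simpa using (tendsto_pow_atTop_nhds_zero_of_abs_lt_one hq).const_mul c
  simp only [weight_mul_of_abs_eq_one hc, weight_pow hq0 hq]
  exact ((hf.tendsto 0).comp hpoint).mul
    (tendsto_const_nhds.div (tendsto_qPoch _ hsq) (qPochInf_self_ne_zero hsq))

theorem summable_mul_weight (hq0 : q ≠ 0) (hq : |q| < 1) (hf : Continuous f) (hc : |c| = 1) :
    Summable fun k : ℕ => c * q ^ k * (f (c * q ^ k) * weight q (c * q ^ k)) := by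
  simp only [mul_assoc c]
  exact (summable_pow_mul_of_tendsto hq (tendsto_mul_weight hq0 hq hf hc)).mul_left c

theorem jacksonIntegrable_mul_weight (hq0 : q ≠ 0) (hq : |q| < 1) (hf : Continuous f) :
    JacksonIntegrable q (-1) 1 fun x => f x * weight q x :=
  ⟨summable_mul_weight hq0 hq hf (by simp), summable_mul_weight hq0 hq hf (by simp)⟩

/-- The weighted integral `∫_{-1}^1 f(x) ω(x) d_q x`. -/
def weightIntegral (q : ℝ) (f : ℝ → ℝ) : ℝ :=
  jacksonIntegral q (-1) 1 fun x => f x * weight q x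

theorem weightIntegral_add (hq0 : q ≠ 0) (hq : |q| < 1) (hf : Continuous f) (hg : Continuous g) :
    weightIntegral q (fun x => f x + g x) = weightIntegral q f + weightIntegral q g := by
  simp only [weightIntegral, add_mul]
  exact jacksonIntegral_add (jacksonIntegrable_mul_weight hq0 hq hf)
    (jacksonIntegrable_mul_weight hq0 hq hg)

theorem weightIntegral_const_mul (q c : ℝ) (f : ℝ → ℝ) :
    weightIntegral q (fun x => c * f x) = c * weightIntegral q f := by
  simp only [weightIntegral, mul_assoc]
  exact jacksonIntegral_const_mul q _ _ c _

theorem weightIntegral_sum (hq0 : q ≠ 0) (hq : |q| < 1) {ι : Type*} {s : Finset ι} {f : ι → ℝ → ℝ}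
    (hf : ∀ i ∈ s, Continuous (f i)) :
    weightIntegral q (fun x => ∑ i ∈ s, f i x) = ∑ i ∈ s, weightIntegral q (f i) := by
  simp only [weightIntegral, sum_mul]
  exact jacksonIntegral_sum fun i hi => jacksonIntegrable_mul_weight hq0 hq (hf i hi)

theorem weightIntegral_one (hq0 : q ≠ 0) (hq : |q| < 1) :
    weightIntegral q (fun _ => 1) = 1 - q := by
  have hneg := qPochInf_neg_self_ne_zero hq
  have hexp : qExp (q ^ 2) q = qPochInf (-q) q := by
    refine mul_left_cancel₀ (left_ne_zero_of_mul_eq_one (qPochInf_sq_mul_qPochInf_neg hq)) ?_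
    rw [qPochInf_sq_mul_qPochInf_neg hq, qPochInf_mul_qExp (abs_sq_lt_one hq) hq]
  have hhalf : jacksonFromZero q 1 (weight q) = (1 - q) * (weight q 1 * qExp (q ^ 2) q) := by
    rw [jacksonFromZero, qExp, ← tsum_mul_left (a := weight q 1)]
    congr 1
    refine tsum_congr fun k => ?_
    rw [one_mul, weight_pow hq0 hq]
    ring
  simp only [weightIntegral, one_mul]
  rw [jacksonIntegral, jacksonFromZero_neg]
  simp only [weight_neg]
  rw [hhalf, hexp, weight_one hq]
  field_simp
  norm_num

/- By the backward shift, `x H_{n+1}(x) ω(x) = F(x) - F(x/q)` with `F = q^n H_n ω`, so the Jackson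
integral telescopes. The weight vanishes at `±1/q`, and the contributions of the two half-intervals
at the origin cancel. -/
theorem weightIntegral_hermite_succ (hq0 : q ≠ 0) (hq : |q| < 1) (n : ℕ) :
    weightIntegral q (hermite (n + 1) q) = 0 := by
  have htelescope (x : ℝ) : x * (hermite (n + 1) q x * weight q x) =
      q ^ n * hermite n q x * weight q x - q ^ n * hermite n q (x / q) * weight q (x / q) := by
    rw [weight_div hq0 hq]
    linear_combination -weight q x * hermite_backward_shift hq0 hq n x
  have hhalf {c : ℝ} (hc : |c| = 1) :
      jacksonFromZero q c (fun x => hermite (n + 1) q x * weight q x) = (1 - q) *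
        (q ^ n * hermite n q 0 * (weight q 1 / qPochInf (q ^ 2) (q ^ 2))) := by
    have hlimit := tendsto_mul_weight (f := fun x => q ^ n * hermite n q x) hq0 hq
      (by fun_prop) hc
    rw [jacksonFromZero_eq_of_mul_eq_sub (f := fun x => hermite (n + 1) q x * weight q x)
      (F := fun x => q ^ n * hermite n q x * weight q x) hq0
      (summable_mul_weight hq0 hq (continuous_hermite (n + 1) q) hc) htelescope hlimit,
      weight_div hq0 hq, ← sq_abs c, hc]
    ring
  rw [weightIntegral, jacksonIntegral, hhalf (by simp), hhalf (by simp), sub_self]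

/-- The squared norm of the discrete `q`-Hermite polynomial of degree `n` for the orthogonality
functional `(1-q)^{-1} ∫_{-1}^1 f(x) ω(x) d_q x`. -/
def normSq (q : ℝ) (n : ℕ) : ℝ := qPoch q q n * q ^ (n * (n - 1) / 2)

theorem normSq_succ (q : ℝ) (n : ℕ) : normSq q (n + 1) = recCoeff q (n + 1) * normSq q n := by
  rw [normSq, normSq, recCoeff_succ, Nat.triangle_succ, qPoch_succ, pow_add]
  ring

theorem normSq_ne_zero (hq0 : q ≠ 0) (hq : |q| < 1) (n : ℕ) : normSq q n ≠ 0 :=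
  mul_ne_zero (qPoch_self_ne_zero hq n) (pow_ne_zero _ hq0)

theorem weightIntegral_mul_hermite_mul (hq0 : q ≠ 0) (hq : |q| < 1) (hg : Continuous g) (n : ℕ) :
    weightIntegral q (fun x => x * (hermite n q x * g x)) =
      weightIntegral q (fun x => hermite (n + 1) q x * g x) +
        recCoeff q n * weightIntegral q (fun x => hermite (n - 1) q x * g x) := by
  rw [← weightIntegral_const_mul, ← weightIntegral_add hq0 hq (by fun_prop) (by fun_prop)]
  simp only [← mul_assoc, mul_hermite hq0 hq, add_mul]

theorem weightIntegral_hermite_succ_mul_hermite (hq0 : q ≠ 0) (hq : |q| < 1) (j k : ℕ) :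
    weightIntegral q (fun x => hermite (j + 1) q x * hermite k q x) =
      weightIntegral q (fun x => hermite j q x * hermite (k + 1) q x) +
        recCoeff q k * weightIntegral q (fun x => hermite j q x * hermite (k - 1) q x) -
        recCoeff q j * weightIntegral q (fun x => hermite (j - 1) q x * hermite k q x) := by
  have hj := weightIntegral_mul_hermite_mul hq0 hq (continuous_hermite k q) j
  have hk := weightIntegral_mul_hermite_mul hq0 hq (continuous_hermite j q) k
  simp only [mul_comm (hermite k q _), mul_comm (hermite (k + 1) q _),
    mul_comm (hermite (k - 1) q _)] at hk
  linear_combination hk - hj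

theorem weightIntegral_hermite_mul_of_lt (hq0 : q ≠ 0) (hq : |q| < 1) {j k : ℕ} (hjk : j < k) :
    weightIntegral q (fun x => hermite j q x * hermite k q x) = 0 := by
  induction j using Nat.strong_induction_on generalizing k with
  | _ j ih =>
    rcases j with _ | j
    · obtain ⟨n, rfl⟩ := Nat.exists_eq_succ_of_ne_zero hjk.ne'
      simpa [hermite_zero] using weightIntegral_hermite_succ hq0 hq n
    · rw [weightIntegral_hermite_succ_mul_hermite hq0 hq, ih j (by lia) (by lia),
        ih j (by lia) (by lia), ih (j - 1) (by lia) (by lia)]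
      ring

theorem weightIntegral_hermite_mul_self (hq0 : q ≠ 0) (hq : |q| < 1) (n : ℕ) :
    weightIntegral q (fun x => hermite n q x * hermite n q x) = (1 - q) * normSq q n := by
  induction n with
  | zero => simpa [hermite_zero, normSq, qPoch] using weightIntegral_one hq0 hq
  | succ n ih =>
    rw [weightIntegral_hermite_succ_mul_hermite hq0 hq, Nat.add_sub_cancel, ih,
      weightIntegral_hermite_mul_of_lt hq0 hq (by lia),
      weightIntegral_hermite_mul_of_lt hq0 hq (by lia), normSq_succ, Nat.cast_add_one]
    ring

theorem weightIntegral_hermite_mul_hermite (hq0 : q ≠ 0) (hq : |q| < 1) (j k : ℕ) :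
    weightIntegral q (fun x => hermite j q x * hermite k q x) =
      if j = k then (1 - q) * normSq q k else 0 := by
  rcases lt_trichotomy j k with h | rfl | h
  · rw [weightIntegral_hermite_mul_of_lt hq0 hq h, if_neg h.ne]
  · rw [weightIntegral_hermite_mul_self hq0 hq, if_pos rfl]
  · simpa only [mul_comm, if_neg h.ne'] using weightIntegral_hermite_mul_of_lt hq0 hq h

end Weight

section Moments

variable {q : ℝ}

theorem moment_integrand_eq (N p : ℕ) (q : ℝ) :
    (fun x => |x| ^ (2 * p) * density N q x) = fun x =>
      (∑ j ∈ range N, ((1 - q) * normSq q j)⁻¹ *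
        (x ^ (2 * p) * (hermite j q x * hermite j q x))) * weight q x := by
  funext x
  rw [(even_two_mul p).pow_abs, density, ← mul_assoc, mul_sum, mul_sum]
  congr 1
  refine sum_congr rfl fun j _ => ?_
  rw [normSq, mul_inv]
  ring

theorem jacksonIntegrable_moment (hq0 : q ≠ 0) (hq : |q| < 1) (N p : ℕ) :
    JacksonIntegrable q (-1) 1 fun x => |x| ^ (2 * p) * density N q x := by
  rw [moment_integrand_eq]
  exact jacksonIntegrable_mul_weight hq0 hq (by fun_prop)

theorem moment_eq_sum (hq0 : q ≠ 0) (hq : |q| < 1) (N p : ℕ) :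
    moment N p q = ∑ j ∈ range N, ((1 - q) * normSq q j)⁻¹ *
      weightIntegral q (fun x => x ^ (2 * p) * (hermite j q x * hermite j q x)) := by
  rw [moment, moment_integrand_eq, ← weightIntegral,
    weightIntegral_sum hq0 hq fun j _ => by fun_prop]
  simp only [weightIntegral_const_mul]

theorem momentHat_term_eq (hq : q < 1) (N p k : ℕ) (c : ℝ) :
    c / √(1 - q) * q ^ k * (|c / √(1 - q) * q ^ k| ^ (2 * p) *
      densityHat N q (c / √(1 - q) * q ^ k)) =
    ((1 - q) ^ p)⁻¹ * (c * q ^ k * (|c * q ^ k| ^ (2 * p) * density N q (c * q ^ k))) := by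
  have hsqrt : 0 < √(1 - q) := Real.sqrt_pos.2 (sub_pos.2 hq)
  have hpow : (1 - q) ^ p = √(1 - q) ^ (2 * p) := by rw [pow_mul, Real.sq_sqrt (sub_pos.2 hq).le]
  rw [densityHat, div_mul_eq_mul_div, mul_div_cancel₀ _ hsqrt.ne', abs_div, abs_of_pos hsqrt,
    div_pow, hpow]
  field_simp

theorem jacksonIntegrable_momentHat (hq0 : q ≠ 0) (hq : |q| < 1) (N p : ℕ) :
    JacksonIntegrable q (-1 / √(1 - q)) (1 / √(1 - q))
      fun x => |x| ^ (2 * p) * densityHat N q x := by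
  simp only [JacksonIntegrable, momentHat_term_eq (lt_of_abs_lt hq)]
  exact (jacksonIntegrable_moment hq0 hq N p).imp (.mul_left _) (.mul_left _)

theorem momentHat_eq (hq : q < 1) (N p : ℕ) :
    momentHat N p q = ((1 - q) ^ p)⁻¹ * moment N p q := by
  simp only [momentHat, moment, jacksonIntegral, jacksonFromZero, momentHat_term_eq hq,
    tsum_mul_left]
  ring

end Moments

section LatticePaths

variable {m : ℕ}

/-- The `i`-th step, `1` or `-1`, of the lattice path whose set of down-steps is `D`. -/
def step {ι : Type*} [DecidableEq ι] (D : Finset ι) (i : ι) : ℤ := if i ∈ D then -1 else 1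

/-- The height after `n` steps of the lattice path that starts at `0` and has the set `D` of
down-steps. -/
def height (D : Finset (Fin m)) (n : ℕ) : ℤ := ∑ k : Fin m, if k < n then step D k else 0

theorem sum_step {ι : Type*} [Fintype ι] [DecidableEq ι] (D : Finset ι) :
    ∑ i, step D i = Fintype.card ι - 2 * #D := by
  have hstep (i : ι) : step D i = 1 - 2 * if i ∈ D then 1 else 0 := by
    rw [step]
    split_ifs <;> rfl
  simp [hstep, mul_comm]

theorem height_zero (D : Finset (Fin m)) : height D 0 = 0 := by simp [height]

theorem height_succ (D : Finset (Fin m)) (i : Fin m) :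
    height D (i + 1) = height D i + step D i := by
  have hsplit (k : Fin m) : (if (k : ℕ) < i + 1 then step D k else 0) =
      (if (k : ℕ) < i then step D k else 0) + if k = i then step D k else 0 := by
    grind
  simp only [height, hsplit, sum_add_distrib]
  simp

theorem height_last (D : Finset (Fin m)) : height D m = m - 2 * #D := by
  simpa [height] using sum_step D

theorem sum_finset_fin_succ {M : Type*} [AddCommMonoid M] (f : Finset (Fin (m + 1)) → M) :
    ∑ D, f D = ∑ E : Finset (Fin m), f (E.map (Fin.succEmb m)) +
      ∑ E : Finset (Fin m), f (insert 0 (E.map (Fin.succEmb m))) := by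
  have hreindex (g : Finset (Fin (m + 1)) → M) :
      ∑ D ∈ (univ.map (Fin.succEmb m)).powerset, g D =
        ∑ E : Finset (Fin m), g (E.map (Fin.succEmb m)) := by
    refine (sum_nbij (fun E : Finset (Fin m) => E.map (Fin.succEmb m)) (fun E _ => ?_)
      (Finset.map_injective _).injOn (fun D hD => ?_) fun _ _ => rfl).symm
    · simp
    · obtain ⟨E, -, rfl⟩ := subset_map_iff.1 (mem_powerset.1 hD)
      exact ⟨E, by simp⟩
  rw [← hreindex, ← hreindex fun E => f (insert 0 E), ← powerset_univ, Fin.univ_succ,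
    cons_eq_insert, sum_powerset_insert (by simp)]
  rfl

theorem height_succ_eq_step_zero_add (D : Finset (Fin (m + 1))) (n : ℕ) :
    height D (n + 1) = step D 0 + ∑ k : Fin m, if k < n then step D k.succ else 0 := by
  simp [height, Fin.sum_univ_succ]

theorem height_map_succ (E : Finset (Fin m)) (n : ℕ) :
    height (E.map (Fin.succEmb m)) (n + 1) = 1 + height E n := by
  rw [height_succ_eq_step_zero_add]
  simp [step, height]

theorem height_insert_map_succ (E : Finset (Fin m)) (n : ℕ) :
    height (insert 0 (E.map (Fin.succEmb m))) (n + 1) = -1 + height E n := by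
  rw [height_succ_eq_step_zero_add]
  simp [step, height]

/-- The weighted number of lattice paths with `m` steps from `x` to `y`, where a down-step
from the height `h` has the weight `V h`. -/
def pathSum (V : ℤ → ℝ) (m : ℕ) (x y : ℤ) : ℝ :=
  ∑ D : Finset (Fin m) with x + height D m = y, ∏ i ∈ D, V (x + height D i)

theorem pathSum_zero (V : ℤ → ℝ) (x y : ℤ) : pathSum V 0 x y = if x = y then 1 else 0 := by
  simp only [pathSum, height_zero, add_zero, eq_empty_of_isEmpty, prod_empty, sum_const]
  split_ifs <;> simp [*]

theorem pathSum_succ (V : ℤ → ℝ) (m : ℕ) (x y : ℤ) :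
    pathSum V (m + 1) x y = pathSum V m (x + 1) y + V x * pathSum V m (x - 1) y := by
  simp only [pathSum, sum_filter, sum_finset_fin_succ, height_map_succ, height_insert_map_succ,
    mul_sum]
  congr 1
  · simp [prod_map, height_map_succ, add_assoc]
  · refine sum_congr rfl fun E _ => ?_
    rw [prod_insert (by simp), prod_map]
    simp [height_insert_map_succ, height_zero, ← sub_eq_add_neg, ← add_assoc]

theorem weightIntegral_pow_mul_hermite_mul_hermite {q : ℝ} (hq0 : q ≠ 0) (hq : |q| < 1)
    (m j k : ℕ) :
    weightIntegral q (fun x => x ^ m * (hermite j q x * hermite k q x)) =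
      (1 - q) * normSq q k * pathSum (recCoeff q) m j k := by
  induction m generalizing j with
  | zero => simp [weightIntegral_hermite_mul_hermite hq0 hq, pathSum_zero]
  | succ m ih =>
    have hrec := weightIntegral_mul_hermite_mul (g := fun x => x ^ m * hermite k q x) hq0 hq
      (by fun_prop) j
    simp only [pow_succ', mul_assoc, mul_left_comm (hermite _ q _) (_ ^ m)] at hrec ih ⊢
    rw [hrec, ih, ih, pathSum_succ]
    rcases j with _ | j
    · simp [recCoeff_zero]
    · simp only [Nat.cast_add_one, Nat.add_sub_cancel, add_sub_cancel_right]
      ring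

/-- The closed lattice paths with `2 * p` steps, encoded by their sets of down-steps. -/
def bridges (p : ℕ) : Finset (Finset (Fin (2 * p))) := powersetCard p univ

theorem mem_bridges {p : ℕ} {D : Finset (Fin (2 * p))} : D ∈ bridges p ↔ #D = p := by
  simp [bridges, mem_powersetCard]

theorem pathSum_self (V : ℤ → ℝ) (p : ℕ) (x : ℤ) :
    pathSum V (2 * p) x x = ∑ D ∈ bridges p, ∏ i ∈ D, V (x + height D i) := by
  rw [pathSum]
  congr 1
  ext D
  simp only [mem_filter_univ, mem_bridges, height_last]
  lia

theorem moment_eq_sum_bridges {q : ℝ} (hq0 : q ≠ 0) (hq : |q| < 1) (N p : ℕ) :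
    moment N p q =
      ∑ j ∈ range N, ∑ D ∈ bridges p, ∏ i ∈ D, recCoeff q (j + height D i) := by
  rw [moment_eq_sum hq0 hq]
  refine sum_congr rfl fun j _ => ?_
  rw [weightIntegral_pow_mul_hermite_mul_hermite hq0 hq, pathSum_self, inv_mul_cancel_left₀]
  exact mul_ne_zero (sub_ne_zero.2 (ne_one_of_abs_lt_one hq).symm) (normSq_ne_zero hq0 hq j)

end LatticePaths

section BridgeStatistics

variable {ι : Type*} {m p : ℕ}

theorem sum_powersetCard_univ_map [Fintype ι] {M : Type*} [AddCommMonoid M] (π : Equiv.Perm ι)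
    (F : Finset ι → M) :
    ∑ D ∈ powersetCard p univ, F (D.map π.toEmbedding) = ∑ D ∈ powersetCard p univ, F D :=
  sum_equiv π.finsetCongr (by simp [mem_powersetCard]) (by simp)

variable [DecidableEq ι]

theorem step_map (π : Equiv.Perm ι) (D : Finset ι) (i : ι) :
    step (D.map π.toEmbedding) i = step D (π.symm i) := by
  simp only [step, mem_map_equiv]

theorem step_mul_self (D : Finset ι) (i : ι) :
    step D i * step D i = 1 := by
  rw [step]
  split_ifs <;> rfl

variable [Fintype ι]

theorem sum_powersetCard_step_mul_step (hι : Fintype.card ι = 2 * p) (i k : ι) :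
    (2 * p - 1) * ∑ D ∈ powersetCard p univ, step D i * step D k =
      p.centralBinom * ((if k = i then 2 * p else 0) - 1) := by
  have hdiag : ∑ D ∈ powersetCard p univ, step D i * step D i = p.centralBinom := by
    simp [step_mul_self, hι, Nat.centralBinom]
  by_cases hk : k = i
  · simp [hk, hdiag, mul_comm]
  have hrow : ∑ l, ∑ D ∈ powersetCard p univ, step D i * step D l = 0 := by
    rw [sum_comm]
    refine sum_eq_zero fun D hD => ?_
    rw [← mul_sum, sum_step, hι, (mem_powersetCard.1 hD).2]
    simp
  have hoff (l : ι) (hl : l ∈ univ.erase i) : ∑ D ∈ powersetCard p univ, step D i * step D l =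
      ∑ D ∈ powersetCard p univ, step D i * step D k := by
    rw [← sum_powersetCard_univ_map (Equiv.swap k l)]
    refine sum_congr rfl fun D _ => ?_
    rw [step_map, step_map, Equiv.symm_swap, Equiv.swap_apply_right,
      Equiv.swap_apply_of_ne_of_ne (Ne.symm hk) (ne_of_mem_erase hl).symm]
  rw [← add_sum_erase _ _ (mem_univ i), sum_congr rfl hoff, hdiag, sum_const,
    card_erase_of_mem (mem_univ i), card_univ, hι, nsmul_eq_mul,
    Nat.cast_pred (hι ▸ Fintype.card_pos_iff.2 ⟨i⟩)] at hrow
  push_cast at hrow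
  rw [if_neg hk]
  linear_combination hrow

theorem sum_powersetCard_sq_linear (hι : Fintype.card ι = 2 * p) (c : ι → ℝ) :
    (2 * p - 1) * ∑ D ∈ powersetCard p univ, (∑ k, c k * step D k) ^ 2 =
      p.centralBinom * (2 * p * ∑ k, c k ^ 2 - (∑ k, c k) ^ 2) := by
  have hcov (i k : ι) : (2 * p - 1) * ∑ D ∈ powersetCard p univ, (step D i : ℝ) * step D k =
      p.centralBinom * ((if k = i then (2 * p : ℝ) else 0) - 1) := by
    exact_mod_cast sum_powersetCard_step_mul_step hι i k
  calc (2 * p - 1) * ∑ D ∈ powersetCard p univ, (∑ k, c k * step D k) ^ 2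
      = ∑ i, ∑ k, c i * c k *
          ((2 * p - 1) * ∑ D ∈ powersetCard p univ, (step D i : ℝ) * step D k) := by
        simp only [sq, sum_mul_sum]
        rw [sum_comm, mul_sum]
        refine sum_congr rfl fun i _ => ?_
        rw [sum_comm, mul_sum]
        refine sum_congr rfl fun k _ => ?_
        rw [mul_left_comm, mul_sum _ _ (c i * c k)]
        exact congr_arg _ (sum_congr rfl fun D _ => by ring)
    _ = p.centralBinom * (2 * p * ∑ k, c k ^ 2 - (∑ k, c k) ^ 2) := by
        simp only [hcov, mul_sub, mul_ite, mul_zero, sum_sub_distrib, sum_ite_eq', mem_univ,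
          if_true, sq, ← sum_mul, ← mul_sum]
        ring

theorem sum_height_succ_sub (D : Finset (Fin m)) (F : ℤ → ℝ) :
    ∑ i : Fin m, (F (height D (i + 1)) - F (height D i)) = F (height D m) - F 0 := by
  rw [Fin.sum_univ_eq_sum_range fun n => F (height D (n + 1)) - F (height D n),
    sum_range_sub fun n => F (height D n), height_zero]

/-- The height of the midpoint of the `i`-th step. -/
def midHeight (D : Finset (Fin m)) (i : Fin m) : ℝ := height D i + step D i / 2

theorem midHeight_of_mem {D : Finset (Fin m)} {i : Fin m} (hi : i ∈ D) :
    midHeight D i = height D i - 1 / 2 := by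
  rw [midHeight, step, if_pos hi]
  push_cast
  ring

theorem sum_mem_eq_sum_step_mul (D : Finset ι) (F : ι → ℝ) :
    ∑ i ∈ D, F i = 1 / 2 * ∑ i, F i - 1 / 2 * ∑ i, step D i * F i := by
  rw [← mul_sub, ← sum_sub_distrib, mul_sum, ← sum_subset (subset_univ D)]
  · refine sum_congr rfl fun i hi => ?_
    rw [step, if_pos hi]
    push_cast
    ring
  · intro i _ hi
    simp [step, hi]

theorem height_last_of_mem_bridges {D : Finset (Fin (2 * p))} (hD : D ∈ bridges p) :
    height D (2 * p) = 0 := by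
  rw [height_last, mem_bridges.1 hD]
  simp

theorem sum_midHeight_mem {D : Finset (Fin (2 * p))} (hD : D ∈ bridges p) :
    ∑ i ∈ D, midHeight D i = 1 / 2 * ∑ i, midHeight D i := by
  have htelescope := sum_height_succ_sub D fun h => (h : ℝ) ^ 2 / 2
  have hstep (i : Fin (2 * p)) : step D i * midHeight D i =
      (height D (i + 1) : ℝ) ^ 2 / 2 - (height D i : ℝ) ^ 2 / 2 := by
    rw [midHeight, height_succ]
    push_cast
    ring
  rw [sum_mem_eq_sum_step_mul, sum_congr rfl fun i _ => hstep i, htelescope,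
    height_last_of_mem_bridges hD]
  simp

theorem sum_midHeight_sq_mem {D : Finset (Fin (2 * p))} (hD : D ∈ bridges p) :
    ∑ i ∈ D, midHeight D i ^ 2 = 1 / 2 * ∑ i, midHeight D i ^ 2 := by
  have htelescope := sum_height_succ_sub D fun h => ((h : ℝ) ^ 3 - h / 4) / 3
  have hstep (i : Fin (2 * p)) : step D i * midHeight D i ^ 2 =
      ((height D (i + 1) : ℝ) ^ 3 - (height D (i + 1) : ℝ) / 4) / 3 -
        ((height D i : ℝ) ^ 3 - (height D i : ℝ) / 4) / 3 := by
    have hsq : (step D i : ℝ) * step D i = 1 := by exact_mod_cast step_mul_self D i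
    rw [midHeight, height_succ]
    push_cast
    linear_combination (-(step D i : ℝ) / 12) * hsq
  rw [sum_mem_eq_sum_step_mul, sum_congr rfl fun i _ => hstep i, htelescope,
    height_last_of_mem_bridges hD]
  simp

/-- The coefficient of the `k`-th step in `midHeight D i`. -/
def midCoeff (i k : Fin m) : ℝ := (if k < i then 1 else 0) + if k = i then 1 / 2 else 0

theorem midHeight_eq_sum (D : Finset (Fin m)) (i : Fin m) :
    midHeight D i = ∑ k, midCoeff i k * step D k := by
  simp [midHeight, height, midCoeff, add_mul, sum_add_distrib, div_eq_inv_mul]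

theorem sum_midCoeff (i : Fin m) : ∑ k, midCoeff i k = i + 1 / 2 := by
  simp [midCoeff, sum_add_distrib, filter_gt_eq_Iio]

theorem sum_midCoeff_sq (i : Fin m) : ∑ k, midCoeff i k ^ 2 = i + 1 / 4 := by
  have hsq (k : Fin m) :
      midCoeff i k ^ 2 = (if k < i then 1 else 0) + if k = i then 1 / 4 else 0 := by
    rw [midCoeff]
    split_ifs <;> grind
  simp [hsq, sum_add_distrib, filter_gt_eq_Iio]

theorem sum_midCoeff_left (k : Fin m) : ∑ i, midCoeff i k = m - k - 1 / 2 := by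
  have hcard : ((m - 1 - k : ℕ) : ℝ) = m - 1 - k := by
    rw [Nat.cast_sub (by lia), Nat.cast_pred k.pos]
  simp only [midCoeff, sum_add_distrib, sum_boole, filter_lt_eq_Ioi, Fin.card_Ioi, hcard,
    sum_ite_eq, mem_univ, if_true]
  ring

theorem sum_fin_quadratic (n : ℕ) (a b c : ℝ) :
    ∑ i : Fin n, (a + b * i + c * (i : ℝ) ^ 2) =
      n * (a + b * (n - 1) / 2 + c * (n - 1) * (2 * n - 1) / 6) := by
  rw [Fin.sum_univ_eq_sum_range (fun i => a + b * (i : ℝ) + c * (i : ℝ) ^ 2)]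
  induction n with
  | zero => simp
  | succ n ih =>
    rw [sum_range_succ, ih]
    push_cast
    ring

theorem two_mul_sub_one_ne_zero (p : ℕ) : (2 * p - 1 : ℝ) ≠ 0 := by
  exact_mod_cast (by lia : (2 * p - 1 : ℤ) ≠ 0)

theorem sum_bridges_sq_linear (c : Fin (2 * p) → ℝ) :
    (2 * p - 1) * ∑ D ∈ bridges p, (∑ k, c k * step D k) ^ 2 =
      p.centralBinom * (2 * p * ∑ k, c k ^ 2 - (∑ k, c k) ^ 2) :=
  sum_powersetCard_sq_linear (Fintype.card_fin _) c

theorem sum_bridges_sum_midHeight_sq (p : ℕ) :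
    ∑ D ∈ bridges p, ∑ i ∈ D, midHeight D i ^ 2 =
      p.centralBinom * (p * (4 * p - 1) / 12) := by
  have hquadratic (i : Fin (2 * p)) : 2 * p * (i + 1 / 4 : ℝ) - (i + 1 / 2) ^ 2 =
      (2 * p - 1) / 4 + (2 * p - 1) * i + -1 * (i : ℝ) ^ 2 := by ring
  apply mul_left_cancel₀ (two_mul_sub_one_ne_zero p)
  calc (2 * p - 1) * ∑ D ∈ bridges p, ∑ i ∈ D, midHeight D i ^ 2
      = 1 / 2 * ∑ i, (2 * p - 1) * ∑ D ∈ bridges p, (∑ k, midCoeff i k * step D k) ^ 2 := by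
        rw [sum_congr rfl fun D hD => sum_midHeight_sq_mem hD, ← mul_sum, sum_comm, ← mul_sum]
        simp only [midHeight_eq_sum]
        ring
    _ = (2 * p - 1) * (p.centralBinom * (p * (4 * p - 1) / 12)) := by
        simp only [sum_bridges_sq_linear, sum_midCoeff, sum_midCoeff_sq, hquadratic, ← mul_sum,
          sum_fin_quadratic]
        push_cast
        ring

theorem sum_bridges_sq_sum_midHeight (p : ℕ) :
    ∑ D ∈ bridges p, (∑ i ∈ D, midHeight D i) ^ 2 =
      p.centralBinom * (p ^ 2 * (2 * p + 1) / 12) := by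
  have hlinear (D : Finset (Fin (2 * p))) (hD : D ∈ bridges p) :
      ∑ i ∈ D, midHeight D i = 1 / 2 * ∑ k, (∑ i, midCoeff i k) * step D k := by
    rw [sum_midHeight_mem hD]
    simp only [midHeight_eq_sum, sum_mul]
    rw [sum_comm]
  have hcoeff (k : Fin (2 * p)) : ((2 * p : ℕ) - k - 1 / 2 : ℝ) =
      (2 * p - 1 / 2) + -1 * k + 0 * (k : ℝ) ^ 2 := by
    push_cast
    ring
  have hcoeffsq (k : Fin (2 * p)) : ((2 * p : ℕ) - k - 1 / 2 : ℝ) ^ 2 =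
      (2 * p - 1 / 2) ^ 2 + -2 * (2 * p - 1 / 2) * k + 1 * (k : ℝ) ^ 2 := by
    push_cast
    ring
  apply mul_left_cancel₀ (two_mul_sub_one_ne_zero p)
  calc (2 * p - 1) * ∑ D ∈ bridges p, (∑ i ∈ D, midHeight D i) ^ 2
      = 1 / 4 * ((2 * p - 1) *
          ∑ D ∈ bridges p, (∑ k, (∑ i, midCoeff i k) * step D k) ^ 2) := by
        rw [sum_congr rfl fun D hD => by rw [hlinear D hD, mul_pow], ← mul_sum]
        ring
    _ = (2 * p - 1) * (p.centralBinom * (p ^ 2 * (2 * p + 1) / 12)) := by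
        rw [sum_bridges_sq_linear]
        simp only [sum_midCoeff_left, hcoeffsq, sum_fin_quadratic]
        simp only [hcoeff, sum_fin_quadratic]
        push_cast
        ring

theorem height_map_rev (D : Finset (Fin m)) (i : Fin m) :
    height (D.map Fin.revPerm.toEmbedding) i.rev = height D m - height D (i + 1) := by
  have hsplit (k : Fin m) : (if i < k then step D k else 0) =
      step D k - if (k : ℕ) < i + 1 then step D k else 0 := by
    grind
  simp only [height, step_map]
  rw [← Equiv.sum_comp Fin.revPerm]
  simp only [Fin.revPerm_apply, Fin.val_fin_lt, Fin.rev_lt_rev, Fin.revPerm_symm, Fin.rev_rev,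
    hsplit, sum_sub_distrib]
  simp [sum_step]

theorem midHeight_map_rev {D : Finset (Fin (2 * p))} (hD : D ∈ bridges p) (i : Fin (2 * p)) :
    midHeight (D.map Fin.revPerm.toEmbedding) i.rev = -midHeight D i := by
  rw [midHeight, midHeight, height_map_rev, height_last_of_mem_bridges hD, height_succ, step_map,
    Fin.revPerm_symm, Fin.revPerm_apply, Fin.rev_rev]
  push_cast
  ring

theorem sum_bridges_prod_neg (F : ℝ → ℝ) :
    ∑ D ∈ bridges p, ∏ i ∈ D, F (-midHeight D i) = ∑ D ∈ bridges p, ∏ i ∈ D, F (midHeight D i) := by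
  rw [bridges, ← sum_powersetCard_univ_map Fin.revPerm fun D => ∏ i ∈ D, F (midHeight D i)]
  refine sum_congr rfl fun D hD => ?_
  simp [prod_map, midHeight_map_rev hD]

end BridgeStatistics

section MarkedBridges

/-- The function `e^{-t} - e^{-2t}`; the recurrence coefficients at `q = e^{-θ}` are its values at
the multiples of `θ`, up to the factor `q`. -/
def profile (t : ℝ) : ℝ := Real.exp (-t) - Real.exp (-(2 * t))

theorem exp_neg_mul_recCoeff (θ : ℝ) (n : ℤ) :
    Real.exp (-θ) * recCoeff (Real.exp (-θ)) n = profile (θ * n) := by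
  have hpow : Real.exp (-θ) ^ n = Real.exp (-(θ * n)) := by
    rw [← Real.rpow_intCast, ← Real.exp_mul, neg_mul]
  rw [recCoeff, profile, ← mul_assoc, ← zpow_one_add₀ (Real.exp_ne_zero _),
    add_sub_cancel, hpow, mul_one_sub, ← Real.exp_add]
  ring_nf

theorem exp_pow_mul_moment_eq_sum_profile {θ : ℝ} (hθ : 0 < θ) (N p : ℕ) :
    Real.exp (-θ) ^ p * moment N p (Real.exp (-θ)) =
      ∑ j ∈ range N, ∑ D ∈ bridges p, ∏ i ∈ D, profile (θ * (j + 1 / 2 + midHeight D i)) := by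
  have hq : |Real.exp (-θ)| < 1 := by
    rw [Real.abs_exp, Real.exp_lt_one_iff]
    linarith
  rw [moment_eq_sum_bridges (Real.exp_ne_zero _) hq, mul_sum]
  refine sum_congr rfl fun j _ => ?_
  rw [mul_sum]
  refine sum_congr rfl fun D hD => ?_
  have hpow : Real.exp (-θ) ^ p = ∏ _i ∈ D, Real.exp (-θ) := by simp [mem_bridges.1 hD]
  rw [hpow, ← prod_mul_distrib]
  refine prod_congr rfl fun i hi => ?_
  rw [exp_neg_mul_recCoeff, midHeight_of_mem hi]
  push_cast
  ring_nf

/-- The sum of `d` over `D` in which the elements of the subset `S` are counted twice. -/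
def doubledSum {ι : Type*} (d : ι → ℝ) (D S : Finset ι) : ℝ := ∑ i ∈ D, d i + ∑ i ∈ S, d i

theorem doubledSum_one {ι : Type*} (D S : Finset ι) :
    doubledSum (fun _ => 1) D S = (#D + #S : ℕ) := by
  simp [doubledSum]

theorem prod_profile {ι : Type*} (t : ι → ℝ) (D : Finset ι) :
    ∏ i ∈ D, profile (t i) = ∑ S ∈ D.powerset, (-1) ^ #S * Real.exp (-doubledSum t D S) := by
  have hfactor (i : ι) : profile (t i) = Real.exp (-t i) * (1 + -Real.exp (-t i)) := by
    rw [profile, mul_add, mul_one, mul_neg, ← Real.exp_add]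
    ring_nf
  simp only [hfactor, prod_mul_distrib, prod_one_add, prod_neg, ← Real.exp_sum, mul_sum]
  refine sum_congr rfl fun S _ => ?_
  rw [mul_left_comm, ← Real.exp_add, sum_neg_distrib, sum_neg_distrib, ← neg_add, doubledSum]

/-- The lattice paths with `m` steps some of which are marked: a pair `⟨D, S⟩` of the set `D` of
down-steps and the set `S` of marked steps. -/
abbrev MarkedPath (m : ℕ) : Type := Σ _ : Finset (Fin m), Finset (Fin m)

/-- The closed lattice paths with `2 * p` steps some of whose down-steps are marked. -/
def markedBridges (p : ℕ) : Finset (MarkedPath (2 * p)) :=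
  (bridges p).sigma fun D => D.powerset

variable {m p : ℕ}

/-- The sign of a marked lattice path in the expansion of the moments. -/
def markedSign (c : MarkedPath m) : ℝ := (-1) ^ #c.2

/-- The number of down-steps, the marked ones counted twice. -/
def markedDegree (c : MarkedPath m) : ℕ := #c.1 + #c.2

/-- The total height of the midpoints of the down-steps, the marked ones counted twice. -/
def markedHeight (c : MarkedPath m) : ℝ :=
  doubledSum (midHeight c.1) c.1 c.2

theorem markedDegree_pos (hp : 0 < p) {c} (hc : c ∈ markedBridges p) : 0 < markedDegree c :=
  Nat.add_pos_left ((mem_bridges.1 (mem_sigma.1 hc).1).symm ▸ hp) _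

theorem sum_bridges_prod_profile (θ y : ℝ) :
    ∑ D ∈ bridges p, ∏ i ∈ D, profile (θ * (y + midHeight D i)) =
      ∑ c ∈ markedBridges p, markedSign c * Real.exp (-(θ * markedDegree c * y)) *
        Real.cosh (θ * markedHeight c) := by
  have hexpand (s : ℝ) : ∑ D ∈ bridges p, ∏ i ∈ D, profile (θ * (y + s * midHeight D i)) =
      ∑ c ∈ markedBridges p, markedSign c * Real.exp (-(θ * markedDegree c * y)) *
        Real.exp (-(s * (θ * markedHeight c))) := by
    simp only [prod_profile, markedBridges, sum_sigma]
    refine sum_congr rfl fun D _ => sum_congr rfl fun S _ => ?_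
    rw [mul_assoc, ← Real.exp_add, markedSign]
    congr 2
    simp only [doubledSum, markedDegree, markedHeight, ← mul_sum, sum_add_distrib, sum_const,
      nsmul_eq_mul, Nat.cast_add]
    ring
  have hreflect := sum_bridges_prod_neg (p := p) fun h => profile (θ * (y + h))
  have hpos := hexpand 1
  have hneg := hexpand (-1)
  simp only [one_mul, neg_one_mul, neg_neg] at hpos hneg
  calc ∑ D ∈ bridges p, ∏ i ∈ D, profile (θ * (y + midHeight D i))
      = (∑ D ∈ bridges p, ∏ i ∈ D, profile (θ * (y + midHeight D i)) +
          ∑ D ∈ bridges p, ∏ i ∈ D, profile (θ * (y + -midHeight D i))) / 2 := by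
        rw [hreflect, add_self_div_two]
    _ = _ := by
        rw [hpos, hneg, ← sum_add_distrib, sum_div]
        refine sum_congr rfl fun c _ => ?_
        rw [Real.cosh_eq]
        ring

theorem exp_pow_mul_moment_eq_sum_marked {θ : ℝ} (hθ : 0 < θ) (N p : ℕ) :
    Real.exp (-θ) ^ p * moment N p (Real.exp (-θ)) =
      ∑ c ∈ markedBridges p, markedSign c *
        ((∑ j ∈ range N, Real.exp (-(θ * markedDegree c * (j + 1 / 2)))) *
          Real.cosh (θ * markedHeight c)) := by
  simp only [exp_pow_mul_moment_eq_sum_profile hθ, sum_bridges_prod_profile]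
  rw [sum_comm]
  refine sum_congr rfl fun c _ => ?_
  rw [sum_mul, mul_sum]
  exact sum_congr rfl fun j _ => mul_assoc _ _ _

variable {ι : Type*} (u : ℝ) (d : ι → ℝ)

/-- The signed sum of `f` over the doubled sums of `d` on `D`, each weighted by `u` to the number
of its summands. -/
def doublingSum (D : Finset ι) (f : ℝ → ℝ) : ℝ :=
  ∑ S ∈ D.powerset, (-1) ^ #S * u ^ (#D + #S) * f (doubledSum d D S)

theorem doublingSum_empty (f : ℝ → ℝ) : doublingSum u d ∅ f = f 0 := by
  simp [doublingSum, doubledSum]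

theorem doublingSum_cons {a : ι} {D : Finset ι} (ha : a ∉ D) (f : ℝ → ℝ) :
    doublingSum u d (cons a D ha) f = u * doublingSum u d D (fun x => f (d a + x)) -
      u ^ 2 * doublingSum u d D (fun x => f (2 * d a + x)) := by
  classical
  rw [cons_eq_insert, doublingSum, sum_powerset_insert ha, ← sum_add_distrib, doublingSum,
    doublingSum, mul_sum, mul_sum, ← sum_sub_distrib]
  refine sum_congr rfl fun S hS => ?_
  have haS : a ∉ S := fun h => ha (mem_powerset.1 hS h)
  rw [card_insert_of_notMem ha, card_insert_of_notMem haS, doubledSum, doubledSum, doubledSum,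
    sum_insert ha, sum_insert haS]
  ring_nf

theorem doublingSum_add (D : Finset ι) (f g : ℝ → ℝ) :
    doublingSum u d D (fun x => f x + g x) = doublingSum u d D f + doublingSum u d D g := by
  simp only [doublingSum, mul_add, sum_add_distrib]

theorem doublingSum_const_mul (D : Finset ι) (c : ℝ) (f : ℝ → ℝ) :
    doublingSum u d D (fun x => c * f x) = c * doublingSum u d D f := by
  simp only [doublingSum, mul_sum, mul_left_comm]

theorem doublingSum_one (D : Finset ι) : doublingSum u d D (fun _ => 1) = (u - u ^ 2) ^ #D := by
  induction D using Finset.cons_induction with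
  | empty => simp [doublingSum_empty]
  | cons a D ha ih =>
    rw [doublingSum_cons, ih, card_cons]
    ring

theorem doublingSum_const_add_id (D : Finset ι) (c : ℝ) :
    doublingSum u d D (fun x => c + x) = c * (u - u ^ 2) ^ #D + doublingSum u d D (fun x => x) := by
  rw [← doublingSum_one u d, ← doublingSum_const_mul, ← doublingSum_add]
  simp only [mul_one]

theorem doublingSum_const_add_sq (D : Finset ι) (c : ℝ) :
    doublingSum u d D (fun x => (c + x) ^ 2) = c ^ 2 * (u - u ^ 2) ^ #D +
      2 * c * doublingSum u d D (fun x => x) + doublingSum u d D (fun x => x ^ 2) := by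
  rw [← doublingSum_one u d, ← doublingSum_const_mul, ← doublingSum_const_mul, ← doublingSum_add,
    ← doublingSum_add]
  simp only [mul_one, add_sq]

theorem doublingSum_id (D : Finset ι) :
    (u - u ^ 2) * doublingSum u d D (fun x => x) =
      (u - u ^ 2) ^ #D * ((u - 2 * u ^ 2) * ∑ i ∈ D, d i) := by
  induction D using Finset.cons_induction with
  | empty => simp [doublingSum_empty]
  | cons a D ha ih =>
    rw [doublingSum_cons, doublingSum_const_add_id, doublingSum_const_add_id, card_cons, sum_cons]
    linear_combination (u - u ^ 2) * ih

theorem doublingSum_sq (D : Finset ι) :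
    (u - u ^ 2) ^ 2 * doublingSum u d D (fun x => x ^ 2) =
      (u - u ^ 2) ^ #D * ((u - u ^ 2) * (u - 4 * u ^ 2) * ∑ i ∈ D, d i ^ 2 +
        (u - 2 * u ^ 2) ^ 2 * ((∑ i ∈ D, d i) ^ 2 - ∑ i ∈ D, d i ^ 2)) := by
  induction D using Finset.cons_induction with
  | empty => simp [doublingSum_empty]
  | cons a D ha ih =>
    have hid := doublingSum_id u d D
    rw [doublingSum_cons, doublingSum_const_add_sq, doublingSum_const_add_sq, card_cons, sum_cons,
      sum_cons]
    linear_combination (u - u ^ 2) * ih + (u - u ^ 2) * (2 * d a * (u - 2 * u ^ 2)) * hid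

theorem card_bridges (p : ℕ) : #(bridges p) = p.centralBinom := by
  rw [bridges, card_powersetCard, card_univ, Fintype.card_fin, Nat.centralBinom]

theorem sum_markedSign_mul_pow (p : ℕ) :
    ∑ c ∈ markedBridges p, markedSign c * u ^ markedDegree c =
      p.centralBinom * (u - u ^ 2) ^ p := by
  have hfiber (D : Finset (Fin (2 * p))) (hD : D ∈ bridges p) :
      ∑ S ∈ D.powerset, (-1) ^ #S * u ^ (#D + #S) = (u - u ^ 2) ^ p := by
    simpa [doublingSum, mem_bridges.1 hD] using doublingSum_one u (fun _ => 0) D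
  simp only [markedBridges, sum_sigma, markedSign, markedDegree]
  rw [sum_congr rfl hfiber, sum_const, card_bridges, nsmul_eq_mul]

theorem sum_markedSign_mul_pow_mul_sq (p : ℕ) :
    (u - u ^ 2) ^ 2 * ∑ c ∈ markedBridges p, markedSign c * u ^ markedDegree c *
        (markedHeight c ^ 2 / 2 - markedDegree c ^ 2 / 24) =
      p.centralBinom * (u - u ^ 2) ^ p * (p / 12) *
        ((2 * p - 1) * (u - u ^ 2) * (u - 4 * u ^ 2) + (p - 1) ^ 2 * (u - 2 * u ^ 2) ^ 2) := by
  have hfiber (D : Finset (Fin (2 * p))) (hD : D ∈ bridges p) :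
      (u - u ^ 2) ^ 2 * ∑ S ∈ D.powerset, (-1) ^ #S * u ^ (#D + #S) *
          (doubledSum (midHeight D) D S ^ 2 / 2 - (#D + #S : ℕ) ^ 2 / 24) =
        (u - u ^ 2) ^ p * (((u - u ^ 2) * (u - 4 * u ^ 2) - (u - 2 * u ^ 2) ^ 2) / 2) *
            ∑ i ∈ D, midHeight D i ^ 2 +
          (u - u ^ 2) ^ p * ((u - 2 * u ^ 2) ^ 2 / 2) * (∑ i ∈ D, midHeight D i) ^ 2 -
          (u - u ^ 2) ^ p * ((u - u ^ 2) * (u - 4 * u ^ 2) * p +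
            (u - 2 * u ^ 2) ^ 2 * (p ^ 2 - p)) / 24 := by
    have hheight := doublingSum_sq u (midHeight D) D
    have hdegree := doublingSum_sq u (fun _ => 1) D
    simp only [doublingSum, mem_bridges.1 hD, doubledSum_one, one_pow, sum_const, nsmul_eq_mul,
      mul_one] at hheight hdegree ⊢
    simp only [mul_sub, mul_div_assoc', sum_sub_distrib, ← sum_div]
    linear_combination hheight / 2 - hdegree / 24
  simp only [markedBridges, sum_sigma, markedSign, markedDegree, markedHeight]
  rw [mul_sum, sum_congr rfl hfiber, sum_sub_distrib, sum_add_distrib, ← mul_sum, ← mul_sum,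
    sum_bridges_sum_midHeight_sq, sum_bridges_sq_sum_midHeight, sum_const, nsmul_eq_mul,
    card_bridges]
  ring

end MarkedBridges

section GenusCoefficients

variable {p : ℕ}

theorem hasDerivAt_sum_div_mul_one_sub_pow {ι : Type*} {s : Finset ι} {A : ι → ℕ}
    (hA : ∀ c ∈ s, 0 < A c) (a : ι → ℝ) {x : ℝ} (hx : x ≠ 0) :
    HasDerivAt (fun u => ∑ c ∈ s, a c / A c * (1 - u ^ A c)) (-(∑ c ∈ s, a c * x ^ A c) / x) x := by
  have hterm (c : ι) (hc : c ∈ s) :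
      HasDerivAt (fun u => a c / A c * (1 - u ^ A c)) (-(a c * x ^ A c) / x) x := by
    have hAc : (A c : ℝ) ≠ 0 := by exact_mod_cast (hA c hc).ne'
    convert! ((hasDerivAt_pow (A c) x).const_sub 1).const_mul (a c / A c) using 1
    rw [← pow_sub_one_mul (hA c hc).ne' x]
    field_simp
  convert! HasDerivAt.fun_sum hterm using 1
  rw [← sum_neg_distrib, sum_div]

theorem sum_div_mul_one_sub_pow_eq {ι : Type*} {s : Finset ι} {A : ι → ℕ}
    (hA : ∀ c ∈ s, 0 < A c) {a : ι → ℝ} {g : ℝ → ℝ} (hg : Continuous g) (hg1 : g 1 = 0)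
    (hderiv : ∀ x ∈ Set.Ioo 0 1, HasDerivAt g (-(∑ c ∈ s, a c * x ^ A c) / x) x)
    {u : ℝ} (hu : u ∈ Set.Ioc 0 1) : ∑ c ∈ s, a c / A c * (1 - u ^ A c) = g u := by
  have hconst := constant_of_has_deriv_right_zero (a := u) (b := 1)
    (f := fun x => ∑ c ∈ s, a c / A c * (1 - x ^ A c) - g x) (by fun_prop)
    (fun x hx => by
      have hx0 : 0 < x := hu.1.trans_le hx.1
      rw [← sub_self (-(∑ c ∈ s, a c * x ^ A c) / x)]
      exact ((hasDerivAt_sum_div_mul_one_sub_pow hA a hx0.ne').sub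
        (hderiv x ⟨hx0, hx.2⟩)).hasDerivWithinAt) 1 ⟨hu.2, le_rfl⟩
  simp only [one_pow, sub_self, mul_zero, sum_const_zero, hg1] at hconst
  exact sub_eq_zero.1 hconst.symm

/-- The incomplete beta integral `∫_0^{1-u} t^p (1-t)^{p-1} dt`. -/
def betaIntegral (p : ℕ) (u : ℝ) : ℝ := ∫ t in (0 : ℝ)..(1 - u), t ^ p * (1 - t) ^ (p - 1)

theorem hasDerivAt_betaIntegral (p : ℕ) (u : ℝ) :
    HasDerivAt (betaIntegral p) (-((1 - u) ^ p * u ^ (p - 1))) u := by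
  have hcont : Continuous fun t : ℝ => t ^ p * (1 - t) ^ (p - 1) := by fun_prop
  convert! (hcont.integral_hasStrictDerivAt 0 (1 - u)).hasDerivAt.comp u
    ((hasDerivAt_id u).const_sub 1) using 1
  simp

@[fun_prop]
theorem continuous_betaIntegral (p : ℕ) : Continuous (betaIntegral p) :=
  continuous_iff_continuousAt.2 fun u => (hasDerivAt_betaIntegral p u).continuousAt

theorem betaIntegral_one (p : ℕ) : betaIntegral p 1 = 0 := by simp [betaIntegral]

theorem factorial_two_mul (n : ℕ) :
    (2 * n).factorial = n.centralBinom * n.factorial * n.factorial := by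
  rw [Nat.centralBinom_eq_two_mul_choose, two_mul, Nat.add_choose_mul_factorial_mul_factorial]

theorem regIncBeta_eq (hp : 0 < p) (u : ℝ) :
    regIncBeta (1 - u) (p + 1) p = p * p.centralBinom * betaIntegral p u := by
  obtain ⟨r, rfl⟩ := Nat.exists_eq_add_of_le' hp
  have hGamma_sum : Real.Gamma ((r + 1 : ℕ) + 1 + (r + 1 : ℕ)) = (2 * (r + 1)).factorial := by
    rw [← Real.Gamma_nat_eq_factorial]
    push_cast
    ring_nf
  have hGamma : Real.Gamma (r + 1 : ℕ) = r.factorial := by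
    rw [Nat.cast_succ, Real.Gamma_nat_eq_factorial]
  have hfactorial : ((2 * (r + 1)).factorial : ℝ) =
      (r + 1).centralBinom * (r + 1).factorial * ((r + 1 : ℕ) * r.factorial) := by
    rw [factorial_two_mul]
    push_cast [Nat.factorial_succ]
    ring
  have hintegrand (t : ℝ) : t ^ (((r + 1 : ℕ) : ℝ) + 1 - 1) * (1 - t) ^ (((r + 1 : ℕ) : ℝ) - 1) =
      t ^ (r + 1) * (1 - t) ^ (r + 1 - 1) := by
    rw [add_sub_cancel_right, Real.rpow_natCast, Nat.cast_succ, add_sub_cancel_right,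
      Real.rpow_natCast, Nat.add_sub_cancel]
  simp only [regIncBeta, hGamma_sum, hGamma, hfactorial, Real.Gamma_nat_eq_factorial, hintegrand,
    betaIntegral]
  field_simp

theorem sum_markedSign_div_mul_one_sub_pow (hp : 0 < p) {u : ℝ} (hu : u ∈ Set.Ioc 0 1) :
    ∑ c ∈ markedBridges p, markedSign c / markedDegree c * (1 - u ^ markedDegree c) =
      p.centralBinom * betaIntegral p u := by
  refine sum_div_mul_one_sub_pow_eq (g := fun u => p.centralBinom * betaIntegral p u)
    (fun c => markedDegree_pos hp) (by fun_prop) (by simp [betaIntegral_one]) (fun x hx => ?_) hu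
  convert! (hasDerivAt_betaIntegral p x).const_mul (p.centralBinom : ℝ) using 1
  have hx0 := hx.1.ne'
  rw [sum_markedSign_mul_pow, show x - x ^ 2 = (1 - x) * x by ring, mul_pow,
    ← pow_sub_one_mul hp.ne' x]
  field_simp

theorem hasDerivAt_correction (hp : 0 < p) {x : ℝ} (hx : x ∈ Set.Ioo 0 1) :
    HasDerivAt (fun u => 2 * p * betaIntegral p u +
        u ^ p * (1 - u) ^ (p - 1) * (2 + p - (2 * p + 1) * u))
      ((x - x ^ 2) ^ p * ((2 * p - 1) * (x - x ^ 2) * (x - 4 * x ^ 2) +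
        (p - 1) ^ 2 * (x - 2 * x ^ 2) ^ 2) / ((x - x ^ 2) ^ 2 * x)) x := by
  obtain ⟨r, rfl⟩ := Nat.exists_eq_add_of_le' hp
  have hx0 : x ≠ 0 := hx.1.ne'
  have hx1 : 1 - x ≠ 0 := (sub_pos.2 hx.2).ne'
  have hpred : r * (1 - x) ^ (r - 1) = r * (1 - x) ^ r / (1 - x) := by
    rcases r with _ | r
    · simp
    · rw [Nat.add_sub_cancel, pow_succ]
      field_simp
  convert! ((hasDerivAt_betaIntegral (r + 1) x).const_mul (2 * (r + 1 : ℕ) : ℝ)).add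
    (((hasDerivAt_pow (r + 1) x).mul (((hasDerivAt_id x).const_sub 1).pow r)).mul
      (((hasDerivAt_id x).const_mul (2 * (r + 1 : ℕ) + 1 : ℝ)).const_sub (2 + (r + 1 : ℕ) : ℝ)))
    using 1
  have hfactor : x - x ^ 2 = x * (1 - x) := by ring
  simp only [Nat.add_sub_cancel, id, Pi.mul_apply, Pi.pow_apply, hpred, hfactor, mul_pow]
  push_cast
  field_simp
  ring

theorem sum_markedSign_div_mul_one_sub_pow_mul (hp : 0 < p) {u : ℝ} (hu : u ∈ Set.Ioc 0 1) :
    ∑ c ∈ markedBridges p,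
        markedSign c * (markedHeight c ^ 2 / 2 - markedDegree c ^ 2 / 24) / markedDegree c *
          (1 - u ^ markedDegree c) =
      -(p * p.centralBinom / 12) * (2 * p * betaIntegral p u +
        u ^ p * (1 - u) ^ (p - 1) * (2 + p - (2 * p + 1) * u)) := by
  refine sum_div_mul_one_sub_pow_eq (g := fun u => -(p * p.centralBinom / 12) *
    (2 * p * betaIntegral p u + u ^ p * (1 - u) ^ (p - 1) * (2 + p - (2 * p + 1) * u)))
    (fun c => markedDegree_pos hp) (by fun_prop) ?_ (fun x hx => ?_) hu
  · obtain ⟨r, rfl⟩ := Nat.exists_eq_add_of_le' hp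
    rcases r with _ | r <;> simp [betaIntegral_one]
  · convert! (hasDerivAt_correction hp hx).const_mul (-(p * p.centralBinom / 12 : ℝ)) using 1
    have hsum := sum_markedSign_mul_pow_mul_sq x p
    have hx0 : x ≠ 0 := hx.1.ne'
    have hx1 : x - x ^ 2 ≠ 0 := by nlinarith [mul_pos hx.1 (sub_pos.2 hx.2)]
    simp only [mul_right_comm _ _ (x ^ _)]
    rw [eq_div_of_mul_eq (pow_ne_zero 2 hx1) ((mul_comm _ _).trans hsum)]
    field_simp

theorem genusZeroCoeff_eq (hp : 0 < p) {lam : ℝ} (hlam : 0 ≤ lam) :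
    genusZeroCoeff p lam = 1 / lam * ∑ c ∈ markedBridges p,
      markedSign c / markedDegree c * (1 - Real.exp (-lam) ^ markedDegree c) := by
  rw [genusZeroCoeff, regIncBeta_eq hp, sum_markedSign_div_mul_one_sub_pow hp
    ⟨Real.exp_pos _, Real.exp_le_one_iff.2 (neg_nonpos.2 hlam)⟩]
  field_simp

theorem genusOneCoeff_eq (hp : 0 < p) {lam : ℝ} (hlam : 0 ≤ lam) :
    genusOneCoeff p lam = lam * ∑ c ∈ markedBridges p,
      markedSign c * (markedHeight c ^ 2 / 2 - markedDegree c ^ 2 / 24) / markedDegree c *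
        (1 - Real.exp (-lam) ^ markedDegree c) := by
  have hcentralBinom : ((2 * p - 1).factorial : ℝ) / (p.factorial * (p - 1).factorial) =
      p.centralBinom / 2 := by
    have hfactorial := factorial_two_mul p
    rw [← Nat.mul_factorial_pred (mul_pos two_pos hp).ne', ← Nat.mul_factorial_pred hp.ne']
      at hfactorial
    have hfactorial_real : (2 * p : ℝ) * (2 * p - 1).factorial =
        p.centralBinom * (p * (p - 1).factorial) * (p * (p - 1).factorial) := by
      exact_mod_cast hfactorial
    have hp_ne : (p : ℝ) ≠ 0 := by positivity
    rw [← Nat.mul_factorial_pred hp.ne']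
    push_cast
    field_simp
    exact mul_left_cancel₀ hp_ne (by linear_combination hfactorial_real)
  have hexp : Real.exp (-(p * lam)) = Real.exp (-lam) ^ p := by
    rw [← Real.exp_nat_mul, mul_neg]
  rw [genusOneCoeff, regIncBeta_eq hp, sum_markedSign_div_mul_one_sub_pow_mul hp
    ⟨Real.exp_pos _, Real.exp_le_one_iff.2 (neg_nonpos.2 hlam)⟩, hcentralBinom, hexp]
  ring

end GenusCoefficients

section Asymptotics

theorem exp_neg_sub_sum_range_isBigO (n : ℕ) :
    (fun x : ℝ => Real.exp (-x) - ∑ i ∈ range n, (-x) ^ i / i.factorial)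
      =O[𝓝 0] fun x => x ^ n := by
  have hneg : Tendsto (fun x : ℝ => -x) (𝓝 0) (𝓝 0) := by
    simpa only [neg_zero] using continuous_neg.tendsto (0 : ℝ)
  refine ((Real.exp_sub_sum_range_isBigO_pow n).comp_tendsto hneg).trans
    (IsBigO.of_bound' (Eventually.of_forall fun x => ?_))
  simp only [Function.comp_apply, norm_pow, norm_neg, le_refl]

theorem cosh_sub_isBigO :
    (fun x : ℝ => Real.cosh x - (1 + x ^ 2 / 2)) =O[𝓝 0] fun x => x ^ 4 := by
  refine (((Real.exp_sub_sum_range_isBigO_pow 4).add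
    (exp_neg_sub_sum_range_isBigO 4)).const_mul_left (1 / 2)).congr_left fun x => ?_
  simp only [Real.cosh_eq, sum_range_succ, sum_range_zero, Nat.factorial]
  push_cast
  ring

theorem sinh_sub_isBigO :
    (fun x : ℝ => Real.sinh x - (x + x ^ 3 / 6)) =O[𝓝 0] fun x => x ^ 5 := by
  refine (((Real.exp_sub_sum_range_isBigO_pow 5).sub
    (exp_neg_sub_sum_range_isBigO 5)).const_mul_left (1 / 2)).congr_left fun x => ?_
  simp only [Real.sinh_eq, sum_range_succ, sum_range_zero, Nat.factorial]
  push_cast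
  ring

theorem mul_cosh_sub_sinh_mul_isBigO (w : ℝ) :
    (fun z : ℝ => z * Real.cosh (w * z) - Real.sinh z * (1 + (w ^ 2 / 2 - 1 / 6) * z ^ 2))
      =O[𝓝 0] fun z => z ^ 5 := by
  have hcosh : (fun z : ℝ => z * (Real.cosh (w * z) - (1 + (w * z) ^ 2 / 2)))
      =O[𝓝 0] fun z => z ^ 5 := by
    have hmul : Tendsto (fun z : ℝ => w * z) (𝓝 0) (𝓝 0) := by
      simpa only [mul_zero] using (continuous_const_mul w).tendsto 0
    have hpow : (fun z : ℝ => (w * z) ^ 4) =O[𝓝 0] fun z => z ^ 4 :=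
      ((isBigO_refl _ _).const_mul_left (w ^ 4)).congr_left fun z => (mul_pow w z 4).symm
    exact ((isBigO_refl (fun z : ℝ => z) _).mul
      ((cosh_sub_isBigO.comp_tendsto hmul).trans hpow)).congr_right fun z => (pow_succ' z 4).symm
  have hsinh : (fun z : ℝ => (Real.sinh z - (z + z ^ 3 / 6)) * (1 + (w ^ 2 / 2 - 1 / 6) * z ^ 2))
      =O[𝓝 0] fun z => z ^ 5 := by
    have hbounded : (fun z : ℝ => 1 + (w ^ 2 / 2 - 1 / 6) * z ^ 2) =O[𝓝 0] fun _ => (1 : ℝ) :=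
      ((by fun_prop : Continuous _).tendsto 0).isBigO_one ℝ
    simpa only [mul_one] using sinh_sub_isBigO.mul hbounded
  refine ((hcosh.sub hsinh).add
    ((isBigO_refl _ _).const_mul_left (-((w ^ 2 / 2 - 1 / 6) / 6)))).congr_left fun z => ?_
  ring

theorem cosh_div_sinh_isBigO (w : ℝ) :
    (fun z : ℝ => Real.cosh (w * z) / Real.sinh z - (1 / z + (w ^ 2 / 2 - 1 / 6) * z))
      =O[𝓝[>] 0] fun z => z ^ 3 := by
  have hinv : (fun z : ℝ => (z * Real.sinh z)⁻¹) =O[𝓝[>] 0] fun z => (z * z)⁻¹ := by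
    refine IsBigO.of_bound' (eventually_mem_nhdsWithin.mono fun z (hz : 0 < z) => ?_)
    have hsinh : z ≤ Real.sinh z := Real.self_le_sinh_iff.2 hz.le
    rw [Real.norm_of_nonneg (by positivity), Real.norm_of_nonneg (by positivity)]
    gcongr
  refine (((mul_cosh_sub_sinh_mul_isBigO w).mono nhdsWithin_le_nhds).mul hinv).congr'
    (eventually_mem_nhdsWithin.mono fun z (hz : 0 < z) => ?_)
    (eventually_mem_nhdsWithin.mono fun z (hz : 0 < z) => ?_)
  · have hsinh : Real.sinh z ≠ 0 := (Real.sinh_pos_iff.2 hz).ne'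
    field_simp
  · field_simp

theorem sum_exp_mul_sinh (z : ℝ) (N : ℕ) :
    (∑ j ∈ range N, Real.exp (-(2 * z * (j + 1 / 2)))) * (2 * Real.sinh z) =
      1 - Real.exp (-(2 * z * N)) := by
  have hterm (j : ℕ) : Real.exp (-(2 * z * (j + 1 / 2))) * (2 * Real.sinh z) =
      Real.exp (-(2 * z * j)) - Real.exp (-(2 * z * (j + 1 : ℕ))) := by
    rw [Real.sinh_eq, mul_div_cancel₀ _ (two_ne_zero' ℝ), mul_sub, ← Real.exp_add, ← Real.exp_add]
    push_cast
    ring_nf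
  rw [sum_mul, sum_congr rfl fun j _ => hterm j,
    sum_range_sub' fun j : ℕ => Real.exp (-(2 * z * j))]
  simp

theorem sum_exp_mul_cosh_isBigO {lam : ℝ} (hlam : 0 < lam) {A : ℕ} (hA : 0 < A) (D : ℝ) :
    (fun N : ℕ => (∑ j ∈ range N, Real.exp (-(lam / N * A * (j + 1 / 2)))) *
        Real.cosh (lam / N * D) -
      (1 - Real.exp (-lam) ^ A) / A * (N / lam + lam * (D ^ 2 / 2 - A ^ 2 / 24) / N))
      =O[atTop] fun N : ℕ => 1 / (N : ℝ) ^ 3 := by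
  have hlim : Tendsto (fun N : ℕ => lam * A / 2 / N) atTop (𝓝[>] (0 : ℝ)) := by
    refine tendsto_nhdsWithin_iff.2 ⟨tendsto_const_div_atTop_nhds_zero_nat _, ?_⟩
    filter_upwards [eventually_gt_atTop 0] with N hN
    rw [Set.mem_Ioi]
    positivity
  have hcube : (fun N : ℕ => (lam * A / 2 / N) ^ 3) =O[atTop] fun N : ℕ => 1 / (N : ℝ) ^ 3 :=
    ((isBigO_refl _ _).const_mul_left ((lam * A / 2) ^ 3)).congr_left fun N => by ring
  refine ((((cosh_div_sinh_isBigO (2 * D / A)).comp_tendsto hlim).const_mul_left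
    ((1 - Real.exp (-lam) ^ A) / 2)).trans hcube).congr' ?_ EventuallyEq.rfl
  filter_upwards [eventually_gt_atTop 0] with N hN
  obtain ⟨z, hz⟩ : ∃ z, lam * A / 2 / N = z := ⟨_, rfl⟩
  have hz_pos : 0 < z := by rw [← hz]; positivity
  have hsinh : Real.sinh z ≠ 0 := (Real.sinh_pos_iff.2 hz_pos).ne'
  have hsum : ∑ j ∈ range N, Real.exp (-(lam / N * A * (j + 1 / 2))) =
      (1 - Real.exp (-lam) ^ A) / (2 * Real.sinh z) := by
    have hstep : lam / N * A = 2 * z := by rw [← hz]; ring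
    have hend : Real.exp (-lam) ^ A = Real.exp (-(2 * z * N)) := by
      rw [← Real.exp_nat_mul, ← hz]
      field_simp
    rw [hstep, hend, ← sum_exp_mul_sinh, mul_div_cancel_right₀ _ (by positivity)]
  have hheight : lam / N * D = 2 * D / A * z := by rw [← hz]; field_simp
  have hcoeff : N / lam + lam * (D ^ 2 / 2 - A ^ 2 / 24) / N =
      A / 2 * (1 / z + ((2 * D / A) ^ 2 / 2 - 1 / 6) * z) := by
    rw [← hz]
    field_simp
    ring
  rw [Function.comp_apply, hz, hsum, hheight, hcoeff]
  field_simp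

theorem scaledQ_eq (lam : ℝ) (N : ℕ) : scaledQ lam N = Real.exp (-(lam / N)) := by
  rw [scaledQ, neg_div]

theorem scaledQ_lt_one {lam : ℝ} (hlam : 0 < lam) {N : ℕ} (hN : 0 < N) : scaledQ lam N < 1 := by
  rw [scaledQ_eq, Real.exp_lt_one_iff]
  exact neg_neg_of_pos (by positivity)

theorem scaledQ_pow_mul_moment_eq_sum {lam : ℝ} (hlam : 0 < lam) (p : ℕ) {N : ℕ} (hN : 0 < N) :
    scaledQ lam N ^ p * moment N p (scaledQ lam N) =
      ∑ c ∈ markedBridges p, markedSign c *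
        ((∑ j ∈ range N, Real.exp (-(lam / N * markedDegree c * (j + 1 / 2)))) *
          Real.cosh (lam / N * markedHeight c)) := by
  rw [scaledQ_eq, exp_pow_mul_moment_eq_sum_marked (by positivity)]

theorem genus_expansion_eq_sum {p : ℕ} (hp : 0 < p) {lam : ℝ} (hlam : 0 ≤ lam) (N : ℝ) :
    genusZeroCoeff p lam * N + genusOneCoeff p lam / N =
      ∑ c ∈ markedBridges p, markedSign c * ((1 - Real.exp (-lam) ^ markedDegree c) /
        markedDegree c * (N / lam +
          lam * (markedHeight c ^ 2 / 2 - markedDegree c ^ 2 / 24) / N)) := by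
  rw [genusZeroCoeff_eq hp hlam, genusOneCoeff_eq hp hlam, mul_sum, mul_sum, sum_mul, sum_div,
    ← sum_add_distrib]
  refine sum_congr rfl fun c _ => ?_
  ring

end Asymptotics

end DiscreteQGUE

end

theorem theorem2p2 (lam : ℝ) (hlam : 0 < lam) (p : ℕ) (hp : 0 < p) :
    (∀ N : ℕ, 0 < N →
      DiscreteQGUE.JacksonIntegrable (DiscreteQGUE.scaledQ lam N) (-1) 1
          (fun x => |x| ^ (2 * p) *
            DiscreteQGUE.density N (DiscreteQGUE.scaledQ lam N) x) ∧
        DiscreteQGUE.JacksonIntegrable (DiscreteQGUE.scaledQ lam N)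
          (-1 / √(1 - DiscreteQGUE.scaledQ lam N)) (1 / √(1 - DiscreteQGUE.scaledQ lam N))
          (fun x => |x| ^ (2 * p) *
            DiscreteQGUE.densityHat N (DiscreteQGUE.scaledQ lam N) x) ∧
        DiscreteQGUE.scaledQ lam N ^ p *
            DiscreteQGUE.moment N p (DiscreteQGUE.scaledQ lam N) =
          (DiscreteQGUE.scaledQ lam N * (1 - DiscreteQGUE.scaledQ lam N)) ^ p *
            DiscreteQGUE.momentHat N p (DiscreteQGUE.scaledQ lam N)) ∧
    (fun N : ℕ =>
        DiscreteQGUE.scaledQ lam N ^ p *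
            DiscreteQGUE.moment N p (DiscreteQGUE.scaledQ lam N) -
          (DiscreteQGUE.genusZeroCoeff p lam * (N : ℝ) +
            DiscreteQGUE.genusOneCoeff p lam / (N : ℝ)))
      =O[atTop] fun N : ℕ => 1 / (N : ℝ) ^ 3 := by
  refine ⟨fun N hN => ?_, ?_⟩
  · have hq0 : 0 < DiscreteQGUE.scaledQ lam N := Real.exp_pos _
    have hq1 := DiscreteQGUE.scaledQ_lt_one hlam hN
    have hq : |DiscreteQGUE.scaledQ lam N| < 1 := by rwa [abs_of_pos hq0]
    have hpow : (1 - DiscreteQGUE.scaledQ lam N) ^ p ≠ 0 := pow_ne_zero p (sub_pos.2 hq1).ne'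
    refine ⟨DiscreteQGUE.jacksonIntegrable_moment hq0.ne' hq N p,
      DiscreteQGUE.jacksonIntegrable_momentHat hq0.ne' hq N p, ?_⟩
    rw [DiscreteQGUE.momentHat_eq hq1, mul_pow, mul_assoc, mul_inv_cancel_left₀ hpow]
  · have hterm (c : DiscreteQGUE.MarkedPath (2 * p)) (hc : c ∈ DiscreteQGUE.markedBridges p) :=
      (DiscreteQGUE.sum_exp_mul_cosh_isBigO hlam (DiscreteQGUE.markedDegree_pos hp hc)
        (DiscreteQGUE.markedHeight c)).const_mul_left (DiscreteQGUE.markedSign c)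
    refine (IsBigO.sum hterm).congr' ?_ EventuallyEq.rfl
    filter_upwards [eventually_gt_atTop 0] with N hN
    rw [DiscreteQGUE.scaledQ_pow_mul_moment_eq_sum hlam p hN,
      DiscreteQGUE.genus_expansion_eq_sum hp hlam.le, ← Finset.sum_sub_distrib]
    simp only [Finset.sum_apply, mul_sub]
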